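/- **Theorem.** Fix a real number $\alpha\ge 1$. For $n$ clients $p_1,\dots,p_n\in\mathbb{R}^2$ (repetitions allowed), a *line cover* consists of a horizontal line $y=h$ and finitely many closed Euclidean disks with centers $(c_j,h)$ on this line and radii $r_j\ge 0$, such that every client lies in at least one of the disks; its cost is $\sum_j r_j^{\alpha}$. The number of disks is not limited, and $h$ may be chosen freely. There is an algorithm (a fixed program, depending only on $\alpha$) that, given any $n$ clients in the plane and any $\varepsilon\in(0,1]$, outputs a line cover (the height $h$, the number of disks, and their centers and radii) whose cost is at most $(1+\varepsilon)$ times the cost of every line cover of these clients, over all horizontal lines. With $N=\max(n,2)$, its running time is $$O\!\left(\frac{N^3}{\varepsilon}\log N\right)\ \text{ if }\alpha=1,\qquad O\!\left(\frac{N^5}{\varepsilon}\log N\right)\ \text{ if }\alpha>1,$$ where the implied constants depend only on $\alpha$. In particular it is a fully polynomial-time approximation scheme. The model of computation is the real RAM: a program works on integer registers, exact real registers, and integer and real arrays addressed by integer registers. It is built from elementary operations and comparisons of registers by sequencing, branching and loops. Unit cost is charged for each comparison and each elementary operation, which are: loading a natural number constant; addition and truncated subtraction of natural numbers; $+,-,\times,/$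 and $\sqrt{\cdot}$ on reals; evaluation of the cost function $r\mapsto r^{\alpha}$; conversion of an integer to a real; reading or writing an array cell. There is no rounding of reals to integers. Initially the memory holds $n$, $\varepsilon$, the coordinates of the clients, and zeros elsewhere. -/

import Mathlib

/-! ### Horizontal-line disk covers -/

/-- A finite family of disks whose centers all lie on one horizontal line: the line is
`y = height`, and the `j`-th disk has center `(center j, height)` and radius `radius j`. -/
structure LineCover where
  height : ℝ
  card : ℕ
  center : Fin card → ℝ
  radius : Fin card → ℝ

namespace LineCover

/-- All radii are nonnegative, and every client lies in one of the closed Euclidean disks. -/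
def Covers (D : LineCover) {n : ℕ} (p : Fin n → EuclideanSpace ℝ (Fin 2)) : Prop :=
  (∀ j, 0 ≤ D.radius j) ∧
    ∀ i, ∃ j, p i ∈ Metric.closedBall !₂[D.center j, D.height] (D.radius j)

/-- The total cost `∑ j, (radius j) ^ α`. -/
noncomputable def cost (α : ℝ) (D : LineCover) : ℝ :=
  ∑ j, D.radius j ^ α

end LineCover

/-! ### The real RAM

A program is a finite piece of syntax. It works on integer registers, real registers, and
integer and real arrays; array cells are addressed by the contents of an integer register.
Every elementary operation and every test costs one unit of time. Real numbers are exact. There is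
no way to turn a real number into an integer, and integers are only added and subtracted. -/

namespace RealRAM

/-- A memory configuration. -/
structure State where
  /-- integer registers -/
  nreg : ℕ → ℕ
  /-- real registers -/
  rreg : ℕ → ℝ
  /-- integer arrays: `narr a k` is the cell `k` of the array `a` -/
  narr : ℕ → ℕ → ℕ
  /-- real arrays: `rarr a k` is the cell `k` of the array `a` -/
  rarr : ℕ → ℕ → ℝ

/-- Elementary operations. The arguments are names of registers (`x`, `y`, `z`) or of arrays (`a`),
except that `c` is a literal constant. -/
inductive Instr where
  /-- `x := c` -/
  | nconst (x c : ℕ)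
  /-- `x := y + z` -/
  | nadd (x y z : ℕ)
  /-- `x := y - z`, truncated at zero -/
  | nsub (x y z : ℕ)
  /-- `x := a[y]` -/
  | nload (x a y : ℕ)
  /-- `a[x] := y` -/
  | nstore (a x y : ℕ)
  /-- `x := c` for a real register -/
  | rconst (x c : ℕ)
  /-- `x := y` for a real register `x` and an integer register `y` -/
  | rcast (x y : ℕ)
  /-- `x := y + z` -/
  | radd (x y z : ℕ)
  /-- `x := y - z` -/
  | rsub (x y z : ℕ)
  /-- `x := y * z` -/
  | rmul (x y z : ℕ)
  /-- `x := y / z` (the result is zero when `z = 0`) -/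
  | rdiv (x y z : ℕ)
  /-- `x := √y` (the result is zero when `y < 0`) -/
  | rsqrt (x y : ℕ)
  /-- `x := f y`, where `f` is the cost function `f r = r ^ α` (with `f r = f 0` when `r < 0`) -/
  | rcost (x y : ℕ)
  /-- `x := a[y]` for a real array `a` and an integer register `y` -/
  | rload (x a y : ℕ)
  /-- `a[x] := y` for a real array `a`, an integer register `x` and a real register `y` -/
  | rstore (a x y : ℕ)

open Function in
/-- The effect of an elementary operation, for the cost function `r ↦ r ^ α`. -/
noncomputable def Instr.run (α : ℝ) : Instr → State → State
  | nconst x c, s => { s with nreg := update s.nreg x c }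
  | nadd x y z, s => { s with nreg := update s.nreg x (s.nreg y + s.nreg z) }
  | nsub x y z, s => { s with nreg := update s.nreg x (s.nreg y - s.nreg z) }
  | nload x a y, s => { s with nreg := update s.nreg x (s.narr a (s.nreg y)) }
  | nstore a x y, s =>
      { s with narr := update s.narr a (update (s.narr a) (s.nreg x) (s.nreg y)) }
  | rconst x c, s => { s with rreg := update s.rreg x (c : ℝ) }
  | rcast x y, s => { s with rreg := update s.rreg x (s.nreg y : ℝ) }
  | radd x y z, s => { s with rreg := update s.rreg x (s.rreg y + s.rreg z) }
  | rsub x y z, s => { s with rreg := update s.rreg x (s.rreg y - s.rreg z) }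
  | rmul x y z, s => { s with rreg := update s.rreg x (s.rreg y * s.rreg z) }
  | rdiv x y z, s => { s with rreg := update s.rreg x (s.rreg y / s.rreg z) }
  | rsqrt x y, s => { s with rreg := update s.rreg x (Real.sqrt (s.rreg y)) }
  | rcost x y, s => { s with rreg := update s.rreg x (max (s.rreg y) 0 ^ α) }
  | rload x a y, s => { s with rreg := update s.rreg x (s.rarr a (s.nreg y)) }
  | rstore a x y, s =>
      { s with rarr := update s.rarr a (update (s.rarr a) (s.nreg x) (s.rreg y)) }

/-- Comparisons of two integer registers or of two real registers. -/
inductive Test where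
  | nlt (x y : ℕ)
  | nle (x y : ℕ)
  | rlt (x y : ℕ)
  | rle (x y : ℕ)

/-- The comparison succeeds in the given configuration. -/
def Test.Holds : Test → State → Prop
  | nlt x y, s => s.nreg x < s.nreg y
  | nle x y, s => s.nreg x ≤ s.nreg y
  | rlt x y, s => s.rreg x < s.rreg y
  | rle x y, s => s.rreg x ≤ s.rreg y

/-- Programs: elementary operations, sequencing, branching and loops. -/
inductive Program where
  | skip
  | op (i : Instr)
  | seq (P Q : Program)
  | cond (b : Test) (P Q : Program)
  | loop (b : Test) (P : Program)

/-- `Exec α P s t s'`: the program `P`, started in the configuration `s`, halts after exactly `t`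
units of time in the configuration `s'`. -/
inductive Exec (α : ℝ) : Program → State → ℕ → State → Prop where
  | skip (s : State) : Exec α .skip s 1 s
  | op (i : Instr) (s : State) : Exec α (.op i) s 1 (i.run α s)
  | seq {P Q : Program} {s s' s'' : State} {t t' : ℕ} :
      Exec α P s t s' → Exec α Q s' t' s'' → Exec α (.seq P Q) s (t + t') s''
  | condTrue {b : Test} {P Q : Program} {s s' : State} {t : ℕ} :
      b.Holds s → Exec α P s t s' → Exec α (.cond b P Q) s (t + 1) s'
  | condFalse {b : Test} {P Q : Program} {s s' : State} {t : ℕ} :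
      ¬ b.Holds s → Exec α Q s t s' → Exec α (.cond b P Q) s (t + 1) s'
  | loopTrue {b : Test} {P : Program} {s s' s'' : State} {t t' : ℕ} :
      b.Holds s → Exec α P s t s' → Exec α (.loop b P) s' t' s'' →
        Exec α (.loop b P) s (t + t' + 1) s''
  | loopFalse {b : Test} {P : Program} {s : State} :
      ¬ b.Holds s → Exec α (.loop b P) s 1 s

/-- The machine is deterministic: running time and final configuration are unique. -/
theorem Exec.deterministic {α : ℝ} {P : Program} {s s₁ : State} {t₁ : ℕ}
    (h : Exec α P s t₁ s₁) : ∀ {t₂ : ℕ} {s₂ : State}, Exec α P s t₂ s₂ → t₁ = t₂ ∧ s₁ = s₂ := by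
  induction h with
  | skip s => intro t₂ s₂ h₂; cases h₂; exact ⟨rfl, rfl⟩
  | op i s => intro t₂ s₂ h₂; cases h₂; exact ⟨rfl, rfl⟩
  | seq _ _ ih ih' =>
    intro t₂ s₂ h₂
    cases h₂ with
    | seq h h' =>
      obtain ⟨rfl, rfl⟩ := ih h
      obtain ⟨rfl, rfl⟩ := ih' h'
      exact ⟨rfl, rfl⟩
  | condTrue hb _ ih =>
    intro t₂ s₂ h₂
    cases h₂ with
    | condTrue _ h => obtain ⟨rfl, rfl⟩ := ih h; exact ⟨rfl, rfl⟩
    | condFalse hb' _ => exact absurd hb hb'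
  | condFalse hb _ ih =>
    intro t₂ s₂ h₂
    cases h₂ with
    | condTrue hb' _ => exact absurd hb' hb
    | condFalse _ h => obtain ⟨rfl, rfl⟩ := ih h; exact ⟨rfl, rfl⟩
  | loopTrue hb _ _ ih ih' =>
    intro t₂ s₂ h₂
    cases h₂ with
    | loopTrue _ h h' =>
      obtain ⟨rfl, rfl⟩ := ih h
      obtain ⟨rfl, rfl⟩ := ih' h'
      exact ⟨rfl, rfl⟩
    | loopFalse hb' => exact absurd hb hb'
  | loopFalse hb =>
    intro t₂ s₂ h₂
    cases h₂ with
    | loopTrue hb' _ _ => exact absurd hb' hb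
    | loopFalse _ => exact ⟨rfl, rfl⟩

/-- The input configuration: integer register `0` holds the number `n` of clients, real register `0`
holds `ε`, the real arrays `0` and `1` hold the abscissas and the ordinates of the clients, and
everything else is zero. -/
noncomputable def input {n : ℕ} (p : Fin n → EuclideanSpace ℝ (Fin 2)) (ε : ℝ) : State where
  nreg := fun x => if x = 0 then n else 0
  rreg := fun x => if x = 0 then ε else 0
  narr := fun _ _ => 0
  rarr := fun a k =>
    if h : k < n then
      if a = 0 then p ⟨k, h⟩ 0 else if a = 1 then p ⟨k, h⟩ 1 else 0
    else 0

/-- How a final configuration is read: integer register `0` holds the number of disks, real register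
`0` the height of the line, and the real arrays `0` and `1` the abscissas of the centers and the
radii. -/
def output (s : State) : LineCover where
  height := s.rreg 0
  card := s.nreg 0
  center := fun j => s.rarr 0 j
  radius := fun j => s.rarr 1 j

end RealRAM

/-! For one fixed line the problem is solved exactly, in quadratic time; the scheme then tries about
`K * n / ε` heights with `K = ⌈4 * α⌉₊`. This takes time `O(n^3 / ε)` for every `α ≥ 1`, so both
claimed bounds follow from the same estimate.

Fixed line. Sort the clients by abscissa. Any cover can be rearranged so that each disk serves a run
of consecutive clients: along the line, the powers of two disks differ by an affine function of the
abscissa, so the preference between them changes at most once (`IsOptPartition.le_sum`). Hence the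
optimum is the cheapest partition into segments, found by dynamic programming. One disk contains a
segment iff the intervals of admissible centers of its points have a common point; by Helly's
theorem on the line, pairs decide this. So the least squared radius is the maximum of `pairSq` over
pairs (`segMax_le_sq`, `sub_sqrt_le_add_sqrt`), and row maxima keep it up to date in constant time
per segment.

Height. A height outside the range `[lo, hi]` of the ordinates can be clamped to it. Some candidate
lies within `δ = ε / (K * n) * (hi - lo)` of the result, and adding `δ` to every radius keeps the
cover valid. One disk per client suffices, so at most `n` radii grow; by Minkowski's inequality the
`α`-norm `A ^ (1 / α)` of the radii grows by at most `n * δ`. The lowest and the highest client both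
lie within `A ^ (1 / α)` of the line, so `hi - lo ≤ 2 * A ^ (1 / α)`. The cost thus grows at most by
the factor `(1 + 2 * ε / K) ^ α ≤ 1 + ε` (`exists_candidate_sum_le`).

The rest is a verification of the program by loop invariants with time bounds (`Runs`). -/

namespace RealRAM

/-! ### Total correctness with a time bound -/

/-- The program halts from `s` within `T` units of time, in a configuration that satisfies `Q`. -/
def Runs (α : ℝ) (P : Program) (s : State) (T : ℕ) (Q : State → Prop) : Prop :=
  ∃ t s', Exec α P s t s' ∧ t ≤ T ∧ Q s'

variable {α : ℝ} {P P' : Program} {s : State} {T T' : ℕ} {Q Q' : State → Prop}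

theorem Runs.mono (h : Runs α P s T Q) (hT : T ≤ T') (hQ : ∀ s', Q s' → Q' s') :
    Runs α P s T' Q' := by
  obtain ⟨t, s', he, ht, hq⟩ := h
  exact ⟨t, s', he, ht.trans hT, hQ _ hq⟩

theorem Runs.skip (h : Q s) : Runs α .skip s 1 Q := ⟨1, s, .skip s, le_rfl, h⟩

theorem Runs.op {i : Instr} (h : Q (i.run α s)) : Runs α (.op i) s 1 Q :=
  ⟨1, _, .op i s, le_rfl, h⟩

theorem Runs.seq (h : Runs α P s T fun s' => Runs α P' s' T' Q) :
    Runs α (.seq P P') s (T + T') Q := by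
  obtain ⟨t, s', he, ht, t', s'', he', ht', hq⟩ := h
  exact ⟨t + t', s'', .seq he he', Nat.add_le_add ht ht', hq⟩

theorem Runs.cond {b : Test} (h : b.Holds s → Runs α P s T Q)
    (h' : ¬ b.Holds s → Runs α P' s T Q) : Runs α (.cond b P P') s (T + 1) Q := by
  by_cases hb : b.Holds s
  · obtain ⟨t, s', he, ht, hq⟩ := h hb
    exact ⟨t + 1, s', .condTrue hb he, Nat.succ_le_succ ht, hq⟩
  · obtain ⟨t, s', he, ht, hq⟩ := h' hb
    exact ⟨t + 1, s', .condFalse hb he, Nat.succ_le_succ ht, hq⟩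

/-- A loop that stops exactly when the index of its invariant, which each round decreases,
reaches zero. -/
theorem Runs.loop {b : Test} (I : ℕ → State → Prop)
    (hb : ∀ v s, I v s → (b.Holds s ↔ 0 < v))
    (hP : ∀ v s, 0 < v → I v s → Runs α P s T fun s' => ∃ w < v, I w s') :
    ∀ {v : ℕ} {s : State}, I v s → Runs α (.loop b P) s (v * (T + 1) + 1) (I 0) := by
  intro v
  induction v using Nat.strong_induction_on with
  | _ v ih =>
    intro s hs
    rcases Nat.eq_zero_or_pos v with rfl | hv
    · exact ⟨1, s, .loopFalse fun h => absurd ((hb _ _ hs).1 h) (lt_irrefl 0), by omega, hs⟩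
    · obtain ⟨t, s', he, ht, w, hw, hs'⟩ := hP v s hv hs
      obtain ⟨t', s'', he', ht', hq⟩ := ih w hw hs'
      refine ⟨t + t' + 1, s'', .loopTrue ((hb _ _ hs).2 hv) he he', ?_, hq⟩
      have : (w + 1) * (T + 1) ≤ v * (T + 1) := Nat.mul_le_mul_right _ hw
      rw [Nat.add_mul] at this
      omega

/-- A loop with a counting invariant, that stops exactly when the count reaches `m`. -/
theorem Runs.countLoop {b : Test} {m : ℕ} (I : ℕ → State → Prop)
    (hb : ∀ k s, k ≤ m → I k s → (b.Holds s ↔ k < m))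
    (hP : ∀ k s, k < m → I k s → Runs α P s T (I (k + 1)))
    {k : ℕ} (hk : k ≤ m) (h : I k s) :
    Runs α (.loop b P) s ((m - k) * (T + 1) + 1) (I m) := by
  refine (Runs.loop (fun v s => v ≤ m ∧ I (m - v) s) (v := m - k) (T := T) ?_ ?_ ?_).mono le_rfl ?_
  · rintro v s ⟨hv, hs⟩
    rw [hb _ _ (by omega) hs]
    omega
  · rintro v s hv ⟨hvm, hs⟩
    refine (hP _ s (by omega) hs).mono le_rfl fun s' h' => ⟨v - 1, by omega, by omega, ?_⟩
    rwa [show m - (v - 1) = m - v + 1 by omega]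
  · exact ⟨by omega, by rwa [show m - (m - k) = k by omega]⟩
  · rintro s' ⟨-, h'⟩
    simpa using h'

/-! ### Straight-line code, counting loops, maxima and minima -/

/-- A list of elementary operations. -/
def block : List Instr → Program
  | [] => .skip
  | i :: l => .seq (.op i) (block l)

theorem Runs.block {l : List Instr} (h : Q (l.foldl (fun s i => i.run α s) s)) :
    Runs α (block l) s (l.length + 1) Q := by
  induction l generalizing s with
  | nil => exact Runs.skip h
  | cons i l ih =>
    refine (Runs.seq (T' := l.length + 1) (Runs.op (ih h))).mono ?_ fun _ => id
    simp only [List.length_cons]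
    omega

/-- The register `x` runs from zero up to the contents of the register `y`; the register `1` has to
contain the number one. -/
def forLoop (x y : ℕ) (P : Program) : Program :=
  .seq (.op (.nconst x 0)) (.loop (.nlt x y) (.seq P (.op (.nadd x x 1))))

/-- The invariant is required after the increment of `x`, so that increment never has to be undone
in the proof. Each round pays `T` for the body, one unit for the increment and one for the test. -/
theorem Runs.forLoop {x y m : ℕ} (I : ℕ → State → Prop)
    (hI : ∀ k s, I k s → s.nreg x = k ∧ s.nreg y = m)
    (h0 : I 0 ((Instr.nconst x 0).run α s))
    (hP : ∀ k s, k < m → I k s →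
      Runs α P s T fun s' => I (k + 1) ((Instr.nadd x x 1).run α s')) :
    Runs α (forLoop x y P) s (m * (T + 2) + 2) (I m) := by
  refine (Runs.seq (T' := m * (T + 2) + 1) (Runs.op ?_)).mono (by omega) fun _ => id
  refine (Runs.countLoop (k := 0) (m := m) (T := T + 1) I ?_ ?_ (Nat.zero_le _) h0).mono
    (by simp) fun _ => id
  · intro k s _ hs
    obtain ⟨h1, h2⟩ := hI k s hs
    simp [Test.Holds, h1, h2]
  · intro k s hk hs
    exact Runs.seq ((hP k s hk hs).mono le_rfl fun s' h => Runs.op h)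

/-- `x := max x y` for real registers. -/
def rmax (x y : ℕ) : Program :=
  .cond (.rlt x y) (block [.rconst x 0, .radd x x y]) .skip

/-- `x := min x y` for real registers. -/
def rmin (x y : ℕ) : Program :=
  .cond (.rlt y x) (block [.rconst x 0, .radd x x y]) .skip

/-- There is no copy instruction: `x := y` is written as `x := 0; x := x + y`, which copies
correctly only between distinct registers. -/
theorem Runs.rmax {x y : ℕ} (hxy : y ≠ x)
    (h : Q { s with rreg := Function.update s.rreg x (max (s.rreg x) (s.rreg y)) }) :
    Runs α (rmax x y) s 4 Q := by
  refine Runs.cond (T := 3) (fun hb => Runs.block ?_) fun hb => (Runs.skip ?_).mono (by omega)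
    fun _ => id
  · have : s.rreg x < s.rreg y := hb
    simpa [Instr.run, hxy, max_eq_right this.le] using h
  · have : s.rreg y ≤ s.rreg x := not_lt.1 hb
    simpa [max_eq_left this] using h

theorem Runs.rmin {x y : ℕ} (hxy : y ≠ x)
    (h : Q { s with rreg := Function.update s.rreg x (min (s.rreg x) (s.rreg y)) }) :
    Runs α (rmin x y) s 4 Q := by
  refine Runs.cond (T := 3) (fun hb => Runs.block ?_) fun hb => (Runs.skip ?_).mono (by omega)
    fun _ => id
  · have : s.rreg y < s.rreg x := hb
    simpa [Instr.run, hxy, min_eq_right this.le] using h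
  · have : s.rreg x ≤ s.rreg y := not_lt.1 hb
    simpa [min_eq_left this] using h

end RealRAM

/-! ### Covering points by disks centered on a fixed line -/

namespace LineCover

/-- The squared radius of the smallest disk centered on the `x`-axis that contains two points, whose
abscissas differ by `d` and whose squared ordinates are `A` and `B`. -/
noncomputable def pairSq (d A B : ℝ) : ℝ :=
  if d * d + B ≤ A then A else if d * d + A ≤ B then B else
    (d * d + B - A) / (d + d) * ((d * d + B - A) / (d + d)) + A

/-- The center lies below the first point, below the second, or where both distances agree. In the
last case `d ≠ 0`, as `d = 0` falls under one of the first two. -/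
theorem exists_le_pairSq (d A B : ℝ) :
    ∃ t, t ^ 2 + A ≤ pairSq d A B ∧ (d - t) ^ 2 + B ≤ pairSq d A B := by
  unfold pairSq
  split_ifs with h h'
  · exact ⟨0, by simp, by nlinarith⟩
  · exact ⟨d, by nlinarith, by simp⟩
  · refine ⟨(d * d + B - A) / (d + d), by rw [sq], le_of_eq ?_⟩
    have hd : d ≠ 0 := by
      rintro rfl
      simp at h h'
      linarith
    field_simp
    ring

/-- In the balanced case, failure of the first two conditions puts `l = u / d` into `[0, 1]`. The
average of the two squared distances with weights `1 - l` and `l` is `(t - u) ^ 2` plus the balanced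
value, so the larger distance is never below that value. -/
theorem pairSq_le {d A B t c : ℝ} (h1 : t ^ 2 + A ≤ c) (h2 : (d - t) ^ 2 + B ≤ c) :
    pairSq d A B ≤ c := by
  unfold pairSq
  split_ifs with h h'
  · nlinarith [sq_nonneg t]
  · nlinarith [sq_nonneg (d - t)]
  · have hd : d ≠ 0 := by
      rintro rfl
      simp at h h'
      linarith
    have hd2 : 0 < 2 * d ^ 2 := by positivity
    set u := (d * d + B - A) / (d + d) with hu
    set l := (d * d + B - A) / (2 * d ^ 2) with hl
    have hl0 : 0 ≤ l := div_nonneg (by linarith) hd2.le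
    have hl1 : 0 ≤ 1 - l := by
      rw [sub_nonneg, hl, div_le_one hd2]
      nlinarith
    have e1 : u = l * d := by rw [hu, hl]; field_simp; ring
    have e2 : B = 2 * d * u - d ^ 2 + A := by rw [hu]; field_simp; ring
    have key : (1 - l) * (t ^ 2 + A) + l * ((d - t) ^ 2 + B) = (t - u) ^ 2 + (u * u + A) := by
      rw [e2, e1]; ring
    nlinarith [mul_le_mul_of_nonneg_left h1 hl1, mul_le_mul_of_nonneg_left h2 hl0,
      sq_nonneg (t - u)]

/-! ### The least squared radius for a segment -/

/-- The largest of `0` and the entries `ρ i b` with `i ≤ b < j`. -/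
noncomputable def rowMax (ρ : ℕ → ℕ → ℝ) (i j : ℕ) : ℝ :=
  (Finset.Ico i j).fold max 0 (ρ i)

/-- The largest of `0` and the entries `ρ a b` with `i ≤ a ≤ b < j`. -/
noncomputable def segMax (ρ : ℕ → ℕ → ℝ) (i j : ℕ) : ℝ :=
  (Finset.Ico i j).fold max 0 fun a => rowMax ρ a j

theorem rowMax_self (ρ : ℕ → ℕ → ℝ) (i : ℕ) : rowMax ρ i i = 0 := by simp [rowMax]

theorem segMax_self (ρ : ℕ → ℕ → ℝ) (i : ℕ) : segMax ρ i i = 0 := by simp [segMax]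

/-- Together with `segMax_eq_max` this is the recursion that the program runs: a new end adds one
entry to each row, and a new start adds one row. -/
theorem rowMax_succ (ρ : ℕ → ℕ → ℝ) {i j : ℕ} (h : i ≤ j) :
    rowMax ρ i (j + 1) = max (rowMax ρ i j) (ρ i j) := by
  rw [rowMax, ← Finset.insert_Ico_right_eq_Ico_add_one h, Finset.fold_insert (by simp), max_comm,
    rowMax]

theorem segMax_eq_max (ρ : ℕ → ℕ → ℝ) {i j : ℕ} (h : i < j) :
    segMax ρ i j = max (segMax ρ (i + 1) j) (rowMax ρ i j) := by
  rw [segMax, ← Finset.insert_Ico_add_one_left_eq_Ico h, Finset.fold_insert (by simp), max_comm,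
    segMax]

theorem segMax_le_iff {ρ : ℕ → ℕ → ℝ} {i j : ℕ} {c : ℝ} :
    segMax ρ i j ≤ c ↔ 0 ≤ c ∧ ∀ a b, i ≤ a → a ≤ b → b < j → ρ a b ≤ c := by
  simp only [segMax, rowMax, Finset.fold_max_le, Finset.mem_Ico]
  constructor
  · rintro ⟨h0, h⟩
    exact ⟨h0, fun a b ha hab hb => (h a ⟨ha, by omega⟩).2 b ⟨hab, hb⟩⟩
  · rintro ⟨h0, h⟩
    exact ⟨h0, fun a ha => ⟨h0, fun b hb => h a b ha.1 hb.1 hb.2⟩⟩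

theorem segMax_nonneg (ρ : ℕ → ℕ → ℝ) (i j : ℕ) : 0 ≤ segMax ρ i j :=
  (segMax_le_iff.1 le_rfl).1

theorem le_segMax (ρ : ℕ → ℕ → ℝ) {i j a b : ℕ} (ha : i ≤ a) (hab : a ≤ b) (hb : b < j) :
    ρ a b ≤ segMax ρ i j :=
  (segMax_le_iff.1 le_rfl).2 a b ha hab hb

/-- `pairSq` for the points with coordinates `X k`, `Y k` and the line `y = h`. -/
noncomputable def pairs (X Y : ℕ → ℝ) (h : ℝ) (a b : ℕ) : ℝ :=
  pairSq (X b - X a) ((Y a - h) * (Y a - h)) ((Y b - h) * (Y b - h))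

theorem segMax_pairs_succ (X Y : ℕ → ℝ) (h : ℝ) (j : ℕ) :
    segMax (pairs X Y h) j (j + 1) = (Y j - h) * (Y j - h) := by
  rw [segMax_eq_max _ (Nat.lt_succ_self j), segMax_self, rowMax_succ _ le_rfl, rowMax_self]
  simp [pairs, pairSq, mul_self_nonneg]

/-- The squared radius `segMax` is large enough for any two points of the segment. -/
theorem sub_sqrt_le_add_sqrt (X Y : ℕ → ℝ) (h : ℝ) {i j k l : ℕ} (hk : i ≤ k) (hkj : k < j)
    (hl : i ≤ l) (hlj : l < j) :
    X l - √(segMax (pairs X Y h) i j - (Y l - h) * (Y l - h)) ≤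
      X k + √(segMax (pairs X Y h) i j - (Y k - h) * (Y k - h)) := by
  set R := segMax (pairs X Y h) i j
  have key : ∀ a b, i ≤ a → a ≤ b → b < j →
      |X b - X a| ≤ √(R - (Y a - h) * (Y a - h)) + √(R - (Y b - h) * (Y b - h)) := by
    intro a b ha hab hb
    -- A center that serves both points splits their horizontal distance into two parts, each at
    -- most the half-width of the interval of centers of that point.
    obtain ⟨t, h1, h2⟩ := exists_le_pairSq (X b - X a) ((Y a - h) * (Y a - h))
      ((Y b - h) * (Y b - h))
    have hR : pairSq (X b - X a) ((Y a - h) * (Y a - h)) ((Y b - h) * (Y b - h)) ≤ R :=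
      le_segMax (pairs X Y h) ha hab hb
    have e1 : |t| ≤ √(R - (Y a - h) * (Y a - h)) := Real.abs_le_sqrt (by linarith)
    have e2 : |X b - X a - t| ≤ √(R - (Y b - h) * (Y b - h)) := Real.abs_le_sqrt (by linarith)
    calc |X b - X a| = |t + (X b - X a - t)| := by congr 1; ring
      _ ≤ _ := (abs_add_le _ _).trans (add_le_add e1 e2)
  rcases le_total k l with hkl | hkl
  · linarith [le_abs_self (X l - X k), key k l hk hkl hlj]
  · linarith [neg_abs_le (X k - X l), key l k hl hkl hkj]

/-- The diagonal pairs `(k, k)` give this. It makes the radicands in the half-widths nonnegative, so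
that squaring the square root loses nothing. -/
theorem sq_le_segMax (X Y : ℕ → ℝ) (h : ℝ) {i j k : ℕ} (hk : i ≤ k) (hkj : k < j) :
    (Y k - h) * (Y k - h) ≤ segMax (pairs X Y h) i j := by
  refine le_trans (le_of_eq ?_) (le_segMax (pairs X Y h) hk le_rfl hkj)
  simp [pairs, pairSq]

/-- A disk that contains all points of a segment has squared radius at least `segMax`. -/
theorem segMax_le_sq {X Y : ℕ → ℝ} {h c r : ℝ} {i j : ℕ}
    (H : ∀ k, i ≤ k → k < j → (X k - c) ^ 2 + (Y k - h) ^ 2 ≤ r ^ 2) :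
    segMax (pairs X Y h) i j ≤ r ^ 2 := by
  refine segMax_le_iff.2 ⟨sq_nonneg r, fun a b ha hab hb => ?_⟩
  refine pairSq_le (t := c - X a) ?_ ?_
  · nlinarith [H a ha (by omega)]
  · nlinarith [H b (by omega) hb]

/-! ### Optimal partitions into segments -/

/-- `F k` is the least cost of a partition of `{0, …, k - 1}` into segments, where `{i, …, j - 1}`
costs `g i j`, and an optimal partition has `B k` as the start of the segment that ends in `k`. -/
structure IsOptPartition (g : ℕ → ℕ → ℝ) (n : ℕ) (F : ℕ → ℝ) (B : ℕ → ℕ) : Prop where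
  zero : F 0 = 0
  start_le : ∀ j < n, B j ≤ j
  eq : ∀ j < n, F (j + 1) = F (B j) + g (B j) (j + 1)
  le : ∀ j < n, ∀ i ≤ j, F (j + 1) ≤ F i + g i (j + 1)

/-- By symmetry the optimal costs are determined by `g`. Hence a recomputation for the chosen height
reproduces the cost found in the search. -/
theorem IsOptPartition.unique {g : ℕ → ℕ → ℝ} {n : ℕ} {F F' : ℕ → ℝ} {B B' : ℕ → ℕ}
    (h : IsOptPartition g n F B) (h' : IsOptPartition g n F' B') {k : ℕ} (hk : k ≤ n) :
    F k ≤ F' k := by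
  induction k using Nat.strong_induction_on with
  | _ k ih =>
    rcases k with _ | k
    · rw [h.zero, h'.zero]
    · have hB := h'.start_le k hk
      rw [h'.eq k hk]
      exact (h.le k hk _ hB).trans (by gcongr; exact ih _ (by omega) (by omega))

/-- The cost of covering a segment by one disk on the line `y = h`. -/
noncomputable def segCost (α : ℝ) (X Y : ℕ → ℝ) (h : ℝ) (i j : ℕ) : ℝ :=
  √(segMax (pairs X Y h) i j) ^ α

/-- Induction on the number of points, removing one disk at a time. The disk `j₀` of least power at
the last point takes the longest final run that it contains; every earlier point lies in some other
disk, so the induction hypothesis applies to `J.erase j₀`. -/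
theorem IsOptPartition.le_sum {α : ℝ} (hα : 0 ≤ α) {X Y F : ℕ → ℝ} {B : ℕ → ℕ} {h : ℝ} {n : ℕ}
    (hF : IsOptPartition (segCost α X Y h) n F B) (hX : ∀ a b, a ≤ b → b < n → X a ≤ X b)
    {ι : Type*} [DecidableEq ι] {c r : ι → ℝ} {k : ℕ} (hk : k ≤ n) {J : Finset ι}
    (hr : ∀ j ∈ J, 0 ≤ r j)
    (H : ∀ a < k, ∃ j ∈ J, (X a - c j) ^ 2 + (Y a - h) ^ 2 ≤ r j ^ 2) :
    F k ≤ ∑ j ∈ J, r j ^ α := by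
  induction k using Nat.strong_induction_on generalizing J with
  | _ k ih =>
    rcases k with _ | k
    · rw [hF.zero]
      exact Finset.sum_nonneg fun j hj => Real.rpow_nonneg (hr j hj) α
    · obtain ⟨j₁, hj₁, -⟩ := H k (Nat.lt_succ_self k)
      -- the disk of least power at the last point
      obtain ⟨j₀, hj₀, hmin⟩ := J.exists_min_image (fun j => (X k - c j) ^ 2 - r j ^ 2) ⟨j₁, hj₁⟩
      have hlast : (X k - c j₀) ^ 2 + (Y k - h) ^ 2 ≤ r j₀ ^ 2 := by
        obtain ⟨j, hj, hjk⟩ := H k (Nat.lt_succ_self k)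
        linarith [hmin j hj]
      have hi : ∃ i ≤ k, (∀ a, i ≤ a → a < k + 1 → (X a - c j₀) ^ 2 + (Y a - h) ^ 2 ≤ r j₀ ^ 2) ∧
          ∀ a < i, ∃ j ∈ J.erase j₀, (X a - c j) ^ 2 + (Y a - h) ^ 2 ≤ r j ^ 2 := by
        classical
        have hex : ∃ i, ∀ a, i ≤ a → a < k + 1 →
            (X a - c j₀) ^ 2 + (Y a - h) ^ 2 ≤ r j₀ ^ 2 := ⟨k + 1, fun a h1 h2 => by omega⟩
        refine ⟨Nat.find hex, Nat.find_min' hex fun a h1 h2 => ?_, Nat.find_spec hex, ?_⟩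
        · obtain rfl : a = k := by omega
          exact hlast
        · intro a ha
          -- The point `b` just before the run is not in `j₀`, so another disk `j` contains it; this
          -- `j` will replace `j₀` at every earlier point.
          obtain ⟨b, hb⟩ : ∃ b, Nat.find hex = b + 1 := ⟨Nat.find hex - 1, by omega⟩
          have hbk : b < k + 1 := by
            have : Nat.find hex ≤ k + 1 := Nat.find_min' hex fun a h1 h2 => by omega
            omega
          have hnb : ¬ (X b - c j₀) ^ 2 + (Y b - h) ^ 2 ≤ r j₀ ^ 2 := by
            intro hcon
            refine Nat.find_min hex (m := b) (by omega) fun a h1 h2 => ?_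
            rcases h1.eq_or_lt with rfl | h1
            · exact hcon
            · exact Nat.find_spec hex a (by omega) h2
          obtain ⟨j, hj, hjb⟩ := H b hbk
          have hne : j ≠ j₀ := by rintro rfl; exact hnb hjb
          obtain ⟨j', hj', hja⟩ := H a (by omega)
          by_cases hjj : j' = j₀
          · subst hjj
            refine ⟨j, Finset.mem_erase.2 ⟨hne, hj⟩, ?_⟩
            have hab := hX a b (by omega) (by omega)
            have hbk' := hX b k (by omega) (by omega)
            have e := hmin j hj
            -- The power of `j` minus that of `j'` (which is `j₀`) is affine in the abscissa with
            -- slope `2 * (c j' - c j)`. It is negative at `b` and nonnegative at `k`, so the slope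
            -- is positive and the difference stays negative at `a`: since `j'` contains the point
            -- `a`, so does `j`.
            have hslope : 0 < (c j' - c j) * (X k - X b) := by nlinarith
            have hpos : 0 < c j' - c j := pos_of_mul_pos_left hslope (by linarith)
            nlinarith [mul_le_mul_of_nonneg_left hab hpos.le]
          · exact ⟨j', Finset.mem_erase.2 ⟨hjj, hj'⟩, hja⟩
      obtain ⟨i, hik, hcov, hrest⟩ := hi
      have hFi := ih i (by omega) (by omega) (J := J.erase j₀)
        (fun j hj => hr j (Finset.mem_of_mem_erase hj)) hrest
      have hg : segCost α X Y h i (k + 1) ≤ r j₀ ^ α := by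
        refine Real.rpow_le_rpow (Real.sqrt_nonneg _) ?_ hα
        rw [Real.sqrt_le_left (hr j₀ hj₀)]
        exact segMax_le_sq hcov
      rw [← Finset.sum_erase_add _ _ hj₀]
      exact (hF.le k (by omega) i hik).trans (add_le_add hFi hg)

end LineCover

namespace LineCover

/-! ### Moving the line -/

/-- The chain is `(1 + x) ^ α ≤ exp (x * α) ≤ exp (ε / 2) ≤ 1 / (1 - ε / 2) ≤ 1 + ε`; the last
inequality uses `ε ≤ 1`. -/
theorem one_add_rpow_le {α ε : ℝ} (hα : 0 ≤ α) (hε : 0 < ε) (hε1 : ε ≤ 1) {x : ℝ} (hx : 0 ≤ x)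
    (h : x * α ≤ ε / 2) : (1 + x) ^ α ≤ 1 + ε := by
  have h1 : (1 + x) ^ α ≤ Real.exp (ε / 2) := by
    calc (1 + x) ^ α ≤ Real.exp x ^ α := by
          gcongr; linarith [Real.add_one_le_exp x]
      _ = Real.exp (x * α) := (Real.exp_mul x α).symm
      _ ≤ _ := Real.exp_le_exp.2 h
  refine h1.trans ?_
  have h2 := Real.one_sub_le_exp_neg (ε / 2)
  rw [Real.exp_neg] at h2
  have h3 : 0 < 1 - ε / 2 := by linarith
  have h4 : Real.exp (ε / 2) ≤ (1 - ε / 2)⁻¹ := by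
    rw [le_inv_comm₀ (Real.exp_pos _) h3]; exact h2
  refine h4.trans ?_
  rw [inv_le_iff_one_le_mul₀ h3]
  nlinarith

/-- Minkowski's inequality for `r` and the constant `δ`, whose norm is at most `n * δ` because
`J.card ≤ n ≤ n ^ α`. -/
theorem sum_add_rpow_le {ι : Type*} {α δ : ℝ} (hα : 1 ≤ α) (hδ : 0 ≤ δ) {n : ℕ} (hn : 0 < n)
    {J : Finset ι} (hJ : J.card ≤ n) {r : ι → ℝ} (hr : ∀ j ∈ J, 0 ≤ r j) :
    ∑ j ∈ J, (r j + δ) ^ α ≤ ((∑ j ∈ J, r j ^ α) ^ (1 / α) + n * δ) ^ α := by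
  have hα0 : 0 < α := by linarith
  have h0 : 0 ≤ ∑ j ∈ J, (r j + δ) ^ α :=
    Finset.sum_nonneg fun j hj => Real.rpow_nonneg (add_nonneg (hr j hj) hδ) α
  have h1 := Real.Lp_add_le_of_nonneg J hα (f := r) (g := fun _ => δ) hr fun _ _ => hδ
  have h2 : (∑ j ∈ J, δ ^ α) ^ (1 / α) ≤ n * δ := by
    have hn1 : (1 : ℝ) ≤ n := by exact_mod_cast hn
    have : ∑ j ∈ J, δ ^ α ≤ (n * δ) ^ α := by
      rw [Finset.sum_const, nsmul_eq_mul, Real.mul_rpow (by positivity) hδ]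
      gcongr
      calc (J.card : ℝ) ≤ n := by exact_mod_cast hJ
        _ = (n : ℝ) ^ (1 : ℝ) := (Real.rpow_one _).symm
        _ ≤ (n : ℝ) ^ α := Real.rpow_le_rpow_of_exponent_le hn1 hα
    calc (∑ j ∈ J, δ ^ α) ^ (1 / α) ≤ ((n * δ) ^ α) ^ (1 / α) := by
          gcongr
      _ = n * δ := by
          rw [one_div, Real.rpow_rpow_inv (by positivity) hα0.ne']
  calc ∑ j ∈ J, (r j + δ) ^ α = ((∑ j ∈ J, (r j + δ) ^ α) ^ (1 / α)) ^ α := by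
        rw [one_div, Real.rpow_inv_rpow h0 hα0.ne']
    _ ≤ _ := by
        refine Real.rpow_le_rpow (Real.rpow_nonneg h0 _) ?_ hα0.le
        linarith

/-- Clamping the height of a line to the range of the ordinates brings the line closer to every
point. -/
theorem exists_clamp (lo hi h : ℝ) (hlh : lo ≤ hi) : ∃ h', lo ≤ h' ∧ h' ≤ hi ∧
    ∀ y, lo ≤ y → y ≤ hi → |y - h'| ≤ |y - h| := by
  rcases le_total h lo with h1 | h1
  · refine ⟨lo, le_rfl, hlh, fun y h2 h3 => ?_⟩
    rw [abs_of_nonneg (by linarith), abs_of_nonneg (by linarith)]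
    linarith
  · rcases le_total hi h with h2 | h2
    · refine ⟨hi, hlh, le_rfl, fun y h3 h4 => ?_⟩
      rw [abs_of_nonpos (by linarith), abs_of_nonpos (by linarith)]
      linarith
    · exact ⟨h, h1, h2, fun y _ _ => le_rfl⟩

/-- A disk that contains a point still does so after a move of its center by `δ`, if its radius is
increased by `δ`. -/
theorem sq_add_sq_le_of_abs_sub_le {x u v r δ : ℝ} (hr : 0 ≤ r) (hδ : 0 ≤ δ)
    (h : x ^ 2 + u ^ 2 ≤ r ^ 2) (huv : |v| ≤ |u| + δ) : x ^ 2 + v ^ 2 ≤ (r + δ) ^ 2 := by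
  have hu : |u| ≤ r := abs_le_of_sq_le_sq (by nlinarith [sq_nonneg x]) hr
  have hv : v ^ 2 ≤ (|u| + δ) ^ 2 := by
    rw [← sq_abs v]
    gcongr
  nlinarith [sq_abs u, mul_le_mul_of_nonneg_right hu hδ]

/-- One of finitely many heights between `lo` and `hi` is good enough. -/
theorem exists_candidate_sum_le {ι : Type*} {α ε : ℝ} (hα : 1 ≤ α) (hε : 0 < ε) (hε1 : ε ≤ 1)
    {n K : ℕ} (hn : 0 < n) (hK : 4 * α ≤ K) {X Y : ℕ → ℝ} {lo hi h : ℝ}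
    (hlo : ∀ k < n, lo ≤ Y k) (hhi : ∀ k < n, Y k ≤ hi) (hlo' : ∃ k < n, Y k = lo)
    (hhi' : ∃ k < n, Y k = hi) {J : Finset ι} (hJ : J.card ≤ n) {c r : ι → ℝ}
    (hr : ∀ j ∈ J, 0 ≤ r j) (H : ∀ a < n, ∃ j ∈ J, (X a - c j) ^ 2 + (Y a - h) ^ 2 ≤ r j ^ 2) :
    ∃ (k : ℕ) (r' : ι → ℝ), k * ε ≤ K * n ∧ (∀ j ∈ J, 0 ≤ r' j) ∧
      (∀ a < n, ∃ j ∈ J,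
        (X a - c j) ^ 2 + (Y a - (lo + k * ε / (K * n) * (hi - lo))) ^ 2 ≤ r' j ^ 2) ∧
      ∑ j ∈ J, r' j ^ α ≤ (1 + ε) * ∑ j ∈ J, r j ^ α := by
  have hα0 : 0 < α := by linarith
  have hn0 : (0 : ℝ) < n := by exact_mod_cast hn
  have hK0 : (0 : ℝ) < K := by linarith
  have hL : (0 : ℝ) < K * n := by positivity
  have hlh : lo ≤ hi := by
    obtain ⟨k, hk, e⟩ := hlo'
    exact e ▸ hhi k hk
  obtain ⟨h', h1, h2, hclamp⟩ := exists_clamp lo hi h hlh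
  set δ := ε / (K * n) * (hi - lo) with hδ
  have hδ0 : 0 ≤ δ := mul_nonneg (by positivity) (by linarith)
  -- the candidate just below `h'`
  obtain ⟨k, hk, hclose⟩ : ∃ k : ℕ, k * ε ≤ K * n ∧
      |h' - (lo + k * ε / (K * n) * (hi - lo))| ≤ δ := by
    -- If all ordinates agree, then `δ = 0` and all candidates coincide; otherwise divide by `δ` and
    -- round down.
    rcases hlh.eq_or_lt with e | hlt
    · refine ⟨0, by simpa using hL.le, ?_⟩
      have : h' = lo := by linarith
      simp [this, hδ0]
    · have hδ1 : 0 < δ := mul_pos (by positivity) (by linarith)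
      have hk0 : 0 ≤ (h' - lo) / δ := div_nonneg (by linarith) hδ0
      have hk1 := Nat.floor_le hk0
      have hk2 := Nat.lt_floor_add_one ((h' - lo) / δ)
      refine ⟨⌊(h' - lo) / δ⌋₊, ?_, ?_⟩
      · rw [← le_div_iff₀ hε]
        refine hk1.trans ?_
        rw [div_le_iff₀ hδ1, hδ]
        have : K * n / ε * (ε / (K * n) * (hi - lo)) = hi - lo := by field_simp
        linarith
      · rw [le_div_iff₀ hδ1] at hk1
        rw [div_lt_iff₀ hδ1] at hk2
        have e : (⌊(h' - lo) / δ⌋₊ : ℝ) * ε / (K * n) * (hi - lo) = ⌊(h' - lo) / δ⌋₊ * δ := by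
          rw [hδ]; ring
        rw [e, abs_of_nonneg (by linarith)]
        linarith
  refine ⟨k, fun j => r j + δ, hk, fun j hj => add_nonneg (hr j hj) hδ0, fun a ha => ?_, ?_⟩
  · obtain ⟨j, hj, e⟩ := H a ha
    refine ⟨j, hj, sq_add_sq_le_of_abs_sub_le (hr j hj) hδ0 e ?_⟩
    have := hclamp (Y a) (hlo a ha) (hhi a ha)
    calc |Y a - (lo + k * ε / (K * n) * (hi - lo))|
        = |Y a - h' + (h' - (lo + k * ε / (K * n) * (hi - lo)))| := by congr 1; ring
      _ ≤ |Y a - h'| + |h' - (lo + k * ε / (K * n) * (hi - lo))| := abs_add_le _ _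
      _ ≤ _ := add_le_add this hclose
  · set A := ∑ j ∈ J, r j ^ α with hA
    have hA0 : 0 ≤ A := Finset.sum_nonneg fun j hj => Real.rpow_nonneg (hr j hj) α
    have hrA : ∀ a < n, |Y a - h| ≤ A ^ (1 / α) := by
      intro a ha
      obtain ⟨j, hj, e⟩ := H a ha
      have h3 : |Y a - h| ≤ r j :=
        abs_le_of_sq_le_sq (by nlinarith [sq_nonneg (X a - c j)]) (hr j hj)
      have h4 : r j ^ α ≤ A := Finset.single_le_sum (f := fun j => r j ^ α)
        (fun j hj => Real.rpow_nonneg (hr j hj) α) hj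
      refine h3.trans ?_
      rw [one_div]
      exact (Real.le_rpow_inv_iff_of_pos (hr j hj) hA0 hα0).2 h4
    -- The range of the ordinates is itself a lower bound for the cost, which turns the absolute
    -- error `n * δ` into a relative one.
    have hW : hi - lo ≤ 2 * A ^ (1 / α) := by
      obtain ⟨a, ha, e⟩ := hlo'
      obtain ⟨b, hb, e'⟩ := hhi'
      have h3 := neg_abs_le (Y a - h)
      have h4 := le_abs_self (Y b - h)
      linarith [hrA a ha, hrA b hb]
    refine (sum_add_rpow_le hα hδ0 hn hJ hr).trans ?_
    have hnδ : n * δ ≤ 2 * ε / K * A ^ (1 / α) := by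
      have e : n * δ = ε / K * (hi - lo) := by rw [hδ]; field_simp
      rw [e]
      calc ε / K * (hi - lo) ≤ ε / K * (2 * A ^ (1 / α)) := by gcongr
        _ = _ := by ring
    have hA1 : 0 ≤ A ^ (1 / α) := Real.rpow_nonneg hA0 _
    calc (A ^ (1 / α) + n * δ) ^ α ≤ ((1 + 2 * ε / K) * A ^ (1 / α)) ^ α := by
          refine Real.rpow_le_rpow (by positivity) ?_ hα0.le
          linarith
      _ = (1 + 2 * ε / K) ^ α * A := by
          rw [Real.mul_rpow (by positivity) hA1, one_div, Real.rpow_inv_rpow hA0 hα0.ne']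
      _ ≤ (1 + ε) * A := by
          gcongr
          -- Here `4 * α ≤ K` enters: it gives `2 * ε / K * α ≤ ε / 2`.
          refine one_add_rpow_le hα0.le hε hε1 (by positivity) ?_
          rw [div_mul_eq_mul_div, div_le_iff₀ hK0]
          nlinarith

end LineCover

namespace RealRAM

open LineCover

/-! ### Sorting the clients -/

/-- Inserts the clients one by one into the arrays `2` and `3`, which are kept sorted by abscissa. -/
def sortProg : Program :=
  forLoop 3 0 (.seq (block [.rload 7 0 3, .rload 8 1 3])
    (.seq
      (forLoop 4 3 (.seq (block [.rload 9 2 4])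
        (.cond (.rlt 7 9)
          (block [.rload 10 3 4, .rstore 2 4 7, .rstore 3 4 8, .rconst 7 0, .radd 7 7 9,
            .rconst 8 0, .radd 8 8 10])
          .skip)))
      (block [.rstore 2 3 7, .rstore 3 3 8])))

/-- The input registers are intact, and the arrays `0` and `1` hold `X₀` and `Y₀`. -/
structure HasInput (n : ℕ) (ε : ℝ) (X₀ Y₀ : ℕ → ℝ) (s : State) : Prop where
  n : s.nreg 0 = n
  one : s.nreg 1 = 1
  eps : s.rreg 0 = ε
  x : s.rarr 0 = X₀
  y : s.rarr 1 = Y₀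

/-- The points `(X k, Y k)`, `k < i`, are sorted and are those that `X₀` and `Y₀` list. -/
structure IsSorting (X₀ Y₀ : ℕ → ℝ) (i : ℕ) (X Y : ℕ → ℝ) : Prop where
  mono : ∀ a b, a ≤ b → b < i → X a ≤ X b
  exists_eq : ∀ k < i, ∃ l < i, X l = X₀ k ∧ Y l = Y₀ k
  exists_eq' : ∀ k < i, ∃ l < i, X k = X₀ l ∧ Y k = Y₀ l

/-- The state of the insertion of the `i`-th client when the first `j` places are done. -/
structure InsertInv (X₀ Y₀ : ℕ → ℝ) (i j : ℕ) (X Y : ℕ → ℝ) (x y : ℝ) : Prop where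
  mono : ∀ a b, a ≤ b → b < i → X a ≤ X b
  le : ∀ a < j, X a ≤ x
  exists_eq : ∀ k ≤ i, (∃ l < i, X l = X₀ k ∧ Y l = Y₀ k) ∨ (x = X₀ k ∧ y = Y₀ k)
  exists_eq' : ∀ k < i, ∃ l ≤ i, X k = X₀ l ∧ Y k = Y₀ l
  carry : ∃ l ≤ i, x = X₀ l ∧ y = Y₀ l

variable {X₀ Y₀ X Y : ℕ → ℝ} {i j : ℕ} {x y : ℝ}

theorem InsertInv.init (h : IsSorting X₀ Y₀ i X Y) :
    InsertInv X₀ Y₀ i 0 X Y (X₀ i) (Y₀ i) where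
  mono := h.mono
  le := by simp
  exists_eq k hk := by
    rcases hk.eq_or_lt with rfl | hk
    · exact .inr ⟨rfl, rfl⟩
    · exact .inl (h.exists_eq k hk)
  exists_eq' k hk := by
    obtain ⟨l, hl, e⟩ := h.exists_eq' k hk
    exact ⟨l, hl.le, e⟩
  carry := ⟨i, le_rfl, rfl, rfl⟩

theorem InsertInv.step (h : InsertInv X₀ Y₀ i j X Y x y) (hx : X j ≤ x) :
    InsertInv X₀ Y₀ i (j + 1) X Y x y where
  mono := h.mono
  le a ha := by
    rcases Nat.lt_succ_iff_lt_or_eq.1 ha with ha | rfl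
    · exact h.le a ha
    · exact hx
  exists_eq := h.exists_eq
  exists_eq' := h.exists_eq'
  carry := h.carry

/-- The carried point settles at `j`, and the displaced one is carried on. The order survives
because `x` is at least every earlier entry and less than `X j`. Only sets of points are tracked,
not multiplicities: being a cover depends on nothing else. -/
theorem InsertInv.swap (h : InsertInv X₀ Y₀ i j X Y x y) (hj : j < i) (hx : x < X j) :
    InsertInv X₀ Y₀ i (j + 1) (Function.update X j x) (Function.update Y j y) (X j) (Y j) where
  mono a b hab hb := by
    have := h.mono a b hab hb
    simp only [Function.update_apply]
    split_ifs with h1 h2 h2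
    · exact le_rfl
    · subst h1; exact hx.le.trans this
    · subst h2; exact h.le a (by omega)
    · exact this
  le a ha := by
    simp only [Function.update_apply]
    split_ifs with h1
    · exact hx.le
    · exact h.mono a j (by omega) hj
  exists_eq k hk := by
    rcases h.exists_eq k hk with ⟨l, hl, e⟩ | e
    · by_cases hlj : l = j
      · subst hlj; exact .inr e
      · exact .inl ⟨l, hl, by simpa [hlj] using e⟩
    · exact .inl ⟨j, hj, by simpa using e⟩
  exists_eq' k hk := by
    by_cases hkj : k = j
    · subst hkj; simpa using h.carry
    · simpa [hkj] using h.exists_eq' k hk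
  carry := h.exists_eq' j hj

theorem InsertInv.finish (h : InsertInv X₀ Y₀ i i X Y x y) :
    IsSorting X₀ Y₀ (i + 1) (Function.update X i x) (Function.update Y i y) where
  mono a b hab hb := by
    simp only [Function.update_apply]
    split_ifs with h1 h2 h2
    · exact le_rfl
    · omega
    · exact h.le a (by omega)
    · exact h.mono a b hab (by omega)
  exists_eq k hk := by
    rcases h.exists_eq k (by omega) with ⟨l, hl, e⟩ | e
    · exact ⟨l, by omega, by simpa [hl.ne] using e⟩
    · exact ⟨i, by omega, by simpa using e⟩
  exists_eq' k hk := by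
    by_cases hki : k = i
    · subst hki
      obtain ⟨l, hl, e⟩ := h.carry
      exact ⟨l, by omega, by simpa using e⟩
    · obtain ⟨l, hl, e⟩ := h.exists_eq' k (by omega)
      exact ⟨l, by omega, by simpa [hki] using e⟩

theorem runs_sortProg {α : ℝ} {s : State} {n : ℕ} {ε : ℝ} (hs : HasInput n ε X₀ Y₀ s) :
    Runs α sortProg s (n * (n * 14 + 11) + 2) fun s' =>
      HasInput n ε X₀ Y₀ s' ∧ IsSorting X₀ Y₀ n (s'.rarr 2) (s'.rarr 3) := by
  refine (Runs.forLoop (m := n) (T := n * 14 + 9) (fun i s => HasInput n ε X₀ Y₀ s ∧ s.nreg 3 = i ∧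
    IsSorting X₀ Y₀ i (s.rarr 2) (s.rarr 3)) ?_ ?_ ?_).mono le_rfl ?_
  · exact fun i s h => ⟨h.2.1, h.1.n⟩
  · refine ⟨⟨?_, ?_, ?_, ?_, ?_⟩, ?_, ?_, ?_, ?_⟩ <;> simp [Instr.run, hs.n, hs.one, hs.eps, hs.x, hs.y]
  · rintro i s hi ⟨hs, h3, hsort⟩
    refine (Runs.seq (T := 3) (T' := n * 14 + 5) (Runs.block ?_)).mono (by omega) fun _ => id
    refine (Runs.seq (T := i * 14 + 2) (T' := 3) ?_).mono (by nlinarith) fun _ => id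
    refine (Runs.forLoop (m := i) (T := 12) (fun j s => HasInput n ε X₀ Y₀ s ∧ s.nreg 3 = i ∧
      s.nreg 4 = j ∧ InsertInv X₀ Y₀ i j (s.rarr 2) (s.rarr 3) (s.rreg 7) (s.rreg 8))
      ?_ ?_ ?_).mono le_rfl ?_
    · exact fun j s h => ⟨h.2.2.1, h.2.1⟩
    · refine ⟨⟨?_, ?_, ?_, ?_, ?_⟩, ?_, ?_, ?_⟩
      case refine_8 => simpa [Instr.run, hs.x, hs.y, h3] using InsertInv.init hsort
      all_goals simp [Instr.run, hs.n, hs.one, hs.eps, hs.x, hs.y, h3]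
    · rintro j s hj ⟨hs, h3, h4, hins⟩
      refine Runs.seq (T := 2) (T' := 10) (Runs.block ?_)
      refine (Runs.cond (T := 8) (fun hb => Runs.block ?_) fun hb => (Runs.skip ?_).mono
        (by omega) fun _ => id).mono (by omega) fun _ => id
      · refine ⟨⟨?_, ?_, ?_, ?_, ?_⟩, ?_, ?_, ?_⟩
        case refine_8 =>
          have := hins.swap hj (by simpa [Test.Holds, Instr.run, h4] using hb)
          simpa [Instr.run, h4] using this
        all_goals simp [Instr.run, hs.n, hs.one, hs.eps, hs.x, hs.y, h3, h4]
      · refine ⟨⟨?_, ?_, ?_, ?_, ?_⟩, ?_, ?_, ?_⟩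
        case refine_8 =>
          have := hins.step (by simpa [Test.Holds, Instr.run, h4] using hb)
          simpa [Instr.run, h4] using this
        all_goals simp [Instr.run, hs.n, hs.one, hs.eps, hs.x, hs.y, h3, h4]
    · rintro s ⟨hs, h3, h4, hins⟩
      refine Runs.block ?_
      refine ⟨⟨?_, ?_, ?_, ?_, ?_⟩, ?_, ?_⟩
      case refine_7 =>
        have := hins.finish
        simpa [Instr.run, h3] using this
      all_goals simp [Instr.run, hs.n, hs.one, hs.eps, hs.x, hs.y, h3]
  · exact fun s h => ⟨h.1, h.2.2⟩

/-! ### The range of the ordinates -/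

/-- Puts the least and the greatest ordinate into the registers `1` and `2`. -/
def rangeProg : Program :=
  .seq (block [.nconst 4 0, .rload 1 3 4, .rload 2 3 4])
    (forLoop 3 0 (.seq (block [.rload 7 3 3]) (.seq (rmin 1 7) (rmax 2 7))))

/-- `lo` and `hi` are the least and the greatest of the `Y k` with `k < n`. -/
structure IsRange (Y : ℕ → ℝ) (n : ℕ) (lo hi : ℝ) : Prop where
  lo_le : ∀ k < n, lo ≤ Y k
  le_hi : ∀ k < n, Y k ≤ hi
  exists_lo : 0 < n → ∃ k < n, Y k = lo
  exists_hi : 0 < n → ∃ k < n, Y k = hi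

theorem runs_rangeProg {α : ℝ} {s : State} {n : ℕ} {ε : ℝ} {X₀ Y₀ X Y : ℕ → ℝ}
    (hs : HasInput n ε X₀ Y₀ s) (hX : s.rarr 2 = X) (hY : s.rarr 3 = Y) :
    Runs α rangeProg s (n * 12 + 6) fun s' =>
      HasInput n ε X₀ Y₀ s' ∧ s'.rarr 2 = X ∧ s'.rarr 3 = Y ∧
      IsRange Y n (s'.rreg 1) (s'.rreg 2) := by
  refine (Runs.seq (T := 4) (T' := n * 12 + 2) (Runs.block ?_)).mono (by omega) fun _ => id
  refine (Runs.forLoop (m := n) (T := 10) (fun i s => (HasInput n ε X₀ Y₀ s ∧ s.nreg 3 = i ∧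
    s.rarr 2 = X ∧ s.rarr 3 = Y) ∧ (∀ k < i, s.rreg 1 ≤ Y k) ∧ (∀ k < i, Y k ≤ s.rreg 2) ∧
    (0 < n → ∃ k < n, Y k = s.rreg 1) ∧ (0 < n → ∃ k < n, Y k = s.rreg 2))
    ?_ ?_ ?_).mono le_rfl ?_
  · exact fun i s h => ⟨h.1.2.1, h.1.1.n⟩
  -- Cell `0` initializes both registers; it holds a client only for `0 < n`, hence the condition in
  -- the two existence claims.
  · refine ⟨⟨⟨?_, ?_, ?_, ?_, ?_⟩, ?_, ?_, ?_⟩, ?_, ?_, fun hn => ⟨0, hn, ?_⟩, fun hn => ⟨0, hn, ?_⟩⟩ <;>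
      simp [Instr.run, hs.n, hs.one, hs.eps, hs.x, hs.y, hX, hY]
  · rintro i s hi ⟨⟨hs, h3, hX, hY⟩, h1, h2, h5, h6⟩
    refine Runs.seq (T := 2) (T' := 8) (Runs.block ?_)
    refine Runs.seq (T := 4) (T' := 4) (Runs.rmin (by simp) ?_)
    refine Runs.rmax (by simp) ?_
    refine ⟨⟨⟨?_, ?_, ?_, ?_, ?_⟩, ?_, ?_, ?_⟩, ?_, ?_, ?_, ?_⟩
    case refine_9 =>
      intro k hk
      rcases Nat.lt_succ_iff_lt_or_eq.1 hk with hk | rfl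
      · simp [Instr.run, h1 k hk]
      · simp [Instr.run, h3, hY]
    case refine_10 =>
      intro k hk
      rcases Nat.lt_succ_iff_lt_or_eq.1 hk with hk | rfl
      · simp [Instr.run, h2 k hk]
      · simp [Instr.run, h3, hY]
    case refine_11 =>
      intro hn
      rcases min_choice (s.rreg 1) (Y i) with e | e
      · simpa [Instr.run, h3, hY, e] using h5 hn
      · exact ⟨i, hi, by simp [Instr.run, h3, hY, e]⟩
    case refine_12 =>
      intro hn
      rcases max_choice (s.rreg 2) (Y i) with e | e
      · simpa [Instr.run, h3, hY, e] using h6 hn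
      · exact ⟨i, hi, by simp [Instr.run, h3, hY, e]⟩
    all_goals simp [Instr.run, hs.n, hs.one, hs.eps, hs.x, hs.y, hX, hY, h3]
  · rintro s ⟨⟨hs, h3, hX, hY⟩, h1, h2, h5, h6⟩
    exact ⟨hs, hX, hY, h1, h2, h5, h6⟩

end RealRAM

namespace RealRAM

open LineCover

/-! ### The optimal cover for one line -/

/-- Computes `pairSq d A B` in the register `17`, from `d`, `A`, `B` in the registers `12`, `13`, `11`
and from `d * d + B` and `d * d + A` in `15` and `16`. -/
def pairProg : Program :=
  .cond (.rle 15 13) (block [.rconst 17 0, .radd 17 17 13])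
    (.cond (.rle 16 11) (block [.rconst 17 0, .radd 17 17 11])
      (block [.rsub 17 15 13, .radd 12 12 12, .rdiv 17 17 12, .rmul 17 17 17, .radd 17 17 13]))

/-- Register `12` ends with `d` or `d + d`, depending on the branch; the quantifier over `v` hides
the difference. -/
theorem runs_pairProg {α : ℝ} {s : State} {Q : State → Prop} {d A B : ℝ} (hd : s.rreg 12 = d)
    (hA : s.rreg 13 = A) (hB : s.rreg 11 = B) (h15 : s.rreg 15 = d * d + B)
    (h16 : s.rreg 16 = d * d + A)
    (h : ∀ v, Q { s with
      rreg := Function.update (Function.update s.rreg 12 v) 17 (pairSq d A B) }) :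
    Runs α pairProg s 8 Q := by
  refine Runs.cond (T := 7) (fun hb => (Runs.block ?_).mono (by simp) fun _ => id) fun hb =>
    Runs.cond (T := 6) (fun hb' => (Runs.block ?_).mono (by simp) fun _ => id) fun hb' =>
    Runs.block ?_
  · convert h d using 1
    simp only [Test.Holds, h15, hA] at hb
    subst hd
    simp [Instr.run, pairSq, hb, hA]
  · convert h d using 1
    simp only [Test.Holds, h15, hA, h16, hB] at hb hb'
    subst hd
    simp [Instr.run, pairSq, hb, hb', hB]
  · convert h (d + d) using 1
    simp only [Test.Holds, h15, hA, h16, hB] at hb hb'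
    rw [pairSq, if_neg hb, if_neg hb']
    subst hd
    simp only [Instr.run, List.foldl, State.mk.injEq, true_and, and_true]
    funext r
    by_cases h17 : r = 17
    · subst h17; simp [h15, hA]
    · by_cases h12 : r = 12 <;> simp [h17, h12]

/-- Computes the cost of the segment that starts at the register `5` and ends at the register `3`,
and the total cost with an optimal partition of the preceding points. -/
def segmentProg : Program :=
  .seq (block [.nsub 5 3 4, .rload 12 2 5, .rload 13 3 5, .rsub 13 13 3, .rmul 13 13 13,
      .rsub 12 10 12, .rmul 14 12 12, .radd 15 14 11, .radd 16 14 13])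
    (.seq pairProg
      (.seq (block [.rload 18 5 5])
        (.seq (rmax 18 17)
          (.seq (block [.rstore 5 5 18])
            (.seq (rmax 8 18)
              (block [.rsqrt 19 8, .rcost 19 19, .rload 20 4 5, .radd 19 20 19]))))))

/-- One step of the minimization over the segments with a given end. -/
def startProg : Program :=
  .seq segmentProg
    (.cond (.rlt 19 7)
      (block [.rconst 7 0, .radd 7 7 19, .nconst 6 0, .nadd 6 6 5, .rconst 9 0, .radd 9 9 8])
      .skip)

/-- Fills the arrays with an optimal partition of the sorted points for the line whose height is in
the register `3`: costs in the real array `4`, starts of segments in the integer array `0`, squared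
radii in the real array `6`. The real array `5` holds the row maxima. -/
def lineProg : Program :=
  .seq (block [.nconst 3 0, .rconst 7 0, .rstore 4 3 7])
    (forLoop 3 0
      (.seq (block [.rload 10 2 3, .rload 11 3 3, .rsub 11 11 3, .rmul 11 11 11, .rconst 8 0,
          .rstore 5 3 8, .rsqrt 12 11, .rcost 12 12, .rload 7 4 3, .radd 7 7 12, .nconst 6 0,
          .nadd 6 6 3, .rconst 9 0, .radd 9 9 11, .nadd 7 3 1])
        (.seq (forLoop 4 7 startProg)
          (block [.nadd 7 3 1, .rstore 4 7 7, .nstore 0 3 6, .rstore 6 3 9]))))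

/-- The configurations `s₀` and `s` agree in what the computation for one line does not touch. -/
structure Frame (s₀ s : State) : Prop where
  nreg : ∀ x < 3, s.nreg x = s₀.nreg x
  rreg : ∀ x < 7, s.rreg x = s₀.rreg x
  rarr : ∀ a < 4, s.rarr a = s₀.rarr a

/-- The memory describes an optimal partition of the first `j` points. -/
structure LineResult (α : ℝ) (X Y : ℕ → ℝ) (h : ℝ) (j : ℕ) (s : State) : Prop where
  opt : IsOptPartition (segCost α X Y h) j (s.rarr 4) (s.narr 0)
  rad : ∀ k < j, s.rarr 6 k = segMax (pairs X Y h) (s.narr 0 k) (k + 1)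

/-- The memory holds the best segment that ends with the point `j`, among those that start with one
of the last `l` points. -/
structure StartInv (α : ℝ) (X Y : ℕ → ℝ) (h : ℝ) (j l : ℕ) (s : State) : Prop where
  seg : s.rreg 8 = segMax (pairs X Y h) (j + 1 - l) (j + 1)
  row : ∀ i ≤ j, s.rarr 5 i = rowMax (pairs X Y h) i (if j + 1 ≤ i + l then j + 1 else j)
  start_le : s.nreg 6 ≤ j
  rad : s.rreg 9 = segMax (pairs X Y h) (s.nreg 6) (j + 1)
  eq : s.rreg 7 = s.rarr 4 (s.nreg 6) + segCost α X Y h (s.nreg 6) (j + 1)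
  le : ∀ i ≤ j, j + 1 ≤ i + l → s.rreg 7 ≤ s.rarr 4 i + segCost α X Y h i (j + 1)

/-- What stays constant while the segments that end with the point `j` are inspected. -/
structure StartFrame (X Y : ℕ → ℝ) (h : ℝ) (j l : ℕ) (s : State) : Prop where
  one : s.nreg 1 = 1
  height : s.rreg 3 = h
  x : s.rarr 2 = X
  y : s.rarr 3 = Y
  last : s.nreg 3 = j
  steps : s.nreg 4 = l
  bound : s.nreg 7 = j + 1
  xj : s.rreg 10 = X j
  yj : s.rreg 11 = (Y j - h) * (Y j - h)

/-- The outcome of `segmentProg`, when the segment starts at `i`. -/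
structure SegmentInv (α : ℝ) (X Y : ℕ → ℝ) (h : ℝ) (j i : ℕ) (s s' : State) : Prop where
  start : s'.nreg 5 = i
  seg : s'.rreg 8 = segMax (pairs X Y h) i (j + 1)
  row : ∀ i' ≤ j, s'.rarr 5 i' = rowMax (pairs X Y h) i' (if i ≤ i' then j + 1 else j)
  cost : s'.rreg 19 = s.rarr 4 i + segCost α X Y h i (j + 1)
  best : s'.rreg 7 = s.rreg 7
  bestStart : s'.nreg 6 = s.nreg 6
  bestRad : s'.rreg 9 = s.rreg 9
  costs : s'.rarr 4 = s.rarr 4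
  rads : s'.rarr 6 = s.rarr 6
  starts : s'.narr 0 = s.narr 0

/-- Ends grow in the outer loop and starts decrease in the inner one. So the segment from `i` to `j`
needs only the new pair `(i, j)`, the stored row maximum and the value for the start `i + 1`:
constant time per segment. -/
theorem runs_segmentProg {α : ℝ} {s₀ s : State} {X Y : ℕ → ℝ} {h : ℝ} {j l i : ℕ} (hi : j = i + l)
    (hf : Frame s₀ s) (hs : StartFrame X Y h j l s) (hI : StartInv α X Y h j l s) :
    Runs α segmentProg s 35 fun s' =>
      Frame s₀ s' ∧ StartFrame X Y h j l s' ∧ SegmentInv α X Y h j i s s' := by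
  have hil : j - l = i := by omega
  refine (Runs.seq (T := 10) (T' := 25) (Runs.block ?_)).mono (by omega) fun _ => id
  refine (Runs.seq (T := 8) (T' := 17) (runs_pairProg (d := X j - X i)
    (A := (Y i - h) * (Y i - h)) (B := (Y j - h) * (Y j - h)) ?_ ?_ ?_ ?_ ?_ ?_)).mono
    (by omega) fun _ => id
  iterate 5 simp [Instr.run, hs.last, hs.steps, hs.x, hs.y, hs.height, hs.xj, hs.yj, hil]
  intro v
  refine (Runs.seq (T := 2) (T' := 15) (Runs.block ?_)).mono (by omega) fun _ => id
  refine (Runs.seq (T := 4) (T' := 11) (Runs.rmax (by simp) ?_)).mono (by omega) fun _ => id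
  refine (Runs.seq (T := 2) (T' := 9) (Runs.block ?_)).mono (by omega) fun _ => id
  refine (Runs.seq (T := 4) (T' := 5) (Runs.rmax (by simp) (Runs.block ?_))).mono (by omega)
    fun _ => id
  have hrow : max (s.rarr 5 i) (pairSq (X j - X i) ((Y i - h) * (Y i - h))
      ((Y j - h) * (Y j - h))) = rowMax (pairs X Y h) i (j + 1) := by
    rw [rowMax_succ _ (by omega), hI.row i (by omega), if_neg (by omega)]
    rfl
  have hseg : max (s.rreg 8) (rowMax (pairs X Y h) i (j + 1)) =
      segMax (pairs X Y h) i (j + 1) := by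
    rw [segMax_eq_max _ (by omega : i < j + 1), hI.seg]
    congr 2
    omega
  refine ⟨⟨fun x hx => ?_, fun x hx => ?_, fun x hx => ?_⟩, ⟨?_, ?_, ?_, ?_, ?_, ?_, ?_, ?_, ?_⟩,
    ⟨?_, ?_, fun i' hi' => ?_, ?_, ?_, ?_, ?_, ?_, ?_, ?_⟩⟩
  iterate 3 interval_cases x <;> simp [Instr.run, hf.nreg, hf.rreg, hf.rarr]
  case refine_15 =>
    by_cases e : i' = i
    · subst e
      simp [Instr.run, hs.last, hs.steps, hil, hrow]
    · rw [if_congr (show i ≤ i' ↔ j + 1 ≤ i' + l by omega) rfl rfl, ← hI.row i' hi']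
      simp [Instr.run, hs.last, hs.steps, hil, e]
  all_goals simp [Instr.run, hs.last, hs.steps, hil, hrow, hseg, hs.one, hs.height,
    hs.x, hs.y, hs.bound, hs.xj, hs.yj, segCost]

theorem runs_startProg {α : ℝ} {s₀ s : State} {X Y : ℕ → ℝ} {h : ℝ} {j l : ℕ} (hl : l < j + 1)
    (hf : Frame s₀ s) (hs : StartFrame X Y h j l s) (hr : LineResult α X Y h j s)
    (hI : StartInv α X Y h j l s) :
    Runs α startProg s 43 fun s' =>
      Frame s₀ ((Instr.nadd 4 4 1).run α s') ∧
      StartFrame X Y h j (l + 1) ((Instr.nadd 4 4 1).run α s') ∧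
      LineResult α X Y h j ((Instr.nadd 4 4 1).run α s') ∧
      StartInv α X Y h j (l + 1) ((Instr.nadd 4 4 1).run α s') := by
  obtain ⟨i, hi⟩ : ∃ i, j = i + l := ⟨j - l, by omega⟩
  refine Runs.seq (T := 35) (T' := 8) ((runs_segmentProg hi hf hs hI).mono le_rfl ?_)
  rintro s' ⟨hf', hs', hS⟩
  have e1 : j + 1 - (l + 1) = i := by omega
  have hrow : ∀ i' ≤ j, s'.rarr 5 i' =
      rowMax (pairs X Y h) i' (if j + 1 ≤ i' + (l + 1) then j + 1 else j) := by
    intro i' hi'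
    rw [hS.row i' hi', if_congr (show i ≤ i' ↔ j + 1 ≤ i' + (l + 1) by omega) rfl rfl]
  have hr' : LineResult α X Y h j s' := by
    refine ⟨?_, ?_⟩
    · rw [hS.costs, hS.starts]; exact hr.opt
    · rw [hS.rads, hS.starts]; exact hr.rad
  refine (Runs.cond (T := 7) (fun hb => Runs.block ?_) fun hb => (Runs.skip ?_).mono
    (by omega) fun _ => id).mono (by omega) fun _ => id
  · have hlt : s'.rreg 19 < s'.rreg 7 := hb
    refine ⟨⟨fun x hx => ?_, fun x hx => ?_, fun x hx => ?_⟩, ⟨?_, ?_, ?_, ?_, ?_, ?_, ?_, ?_, ?_⟩,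
      ⟨?_, ?_⟩, ⟨?_, ?_, ?_, ?_, ?_, fun i' hi' hil' => ?_⟩⟩
    iterate 3 interval_cases x <;> simp [Instr.run, hf'.nreg, hf'.rreg, hf'.rarr]
    case refine_13 => exact hr'.opt
    case refine_14 => exact hr'.rad
    case refine_16 => exact hrow
    case refine_20 =>
      have : s'.rreg 19 ≤ s.rarr 4 i' + segCost α X Y h i' (j + 1) := by
        rcases eq_or_ne i' i with rfl | hne
        · exact hS.cost.le
        · exact (hlt.le.trans_eq hS.best).trans (hI.le i' hi' (by omega))
      simpa [Instr.run, hS.costs] using this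
    all_goals simp [Instr.run, hs'.one, hs'.height, hs'.x, hs'.y, hs'.last, hs'.steps, hs'.bound,
      hs'.xj, hs'.yj, hS.start, hS.seg, hS.cost, hS.costs, hi]
  · have hle : s'.rreg 7 ≤ s'.rreg 19 := not_lt.1 hb
    refine ⟨⟨fun x hx => ?_, fun x hx => ?_, fun x hx => ?_⟩, ⟨?_, ?_, ?_, ?_, ?_, ?_, ?_, ?_, ?_⟩,
      ⟨?_, ?_⟩, ⟨?_, ?_, ?_, ?_, ?_, fun i' hi' hil' => ?_⟩⟩
    iterate 3 interval_cases x <;> simp [Instr.run, hf'.nreg, hf'.rreg, hf'.rarr]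
    case refine_13 => exact hr'.opt
    case refine_14 => exact hr'.rad
    case refine_16 => exact hrow
    case refine_20 =>
      have : s'.rreg 7 ≤ s.rarr 4 i' + segCost α X Y h i' (j + 1) := by
        rcases eq_or_ne i' i with rfl | hne
        · exact hle.trans_eq hS.cost
        · exact hS.best.le.trans (hI.le i' hi' (by omega))
      simpa [Instr.run, hS.costs] using this
    all_goals simp [Instr.run, hs'.one, hs'.height, hs'.x, hs'.y, hs'.last, hs'.steps, hs'.bound,
      hs'.xj, hs'.yj, hS.seg, hS.costs, e1, hS.best, hS.bestStart, hS.bestRad, hI.start_le,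
      hI.rad, hI.eq]

theorem runs_lineProg {α : ℝ} {s : State} {n : ℕ} {X Y : ℕ → ℝ} {h : ℝ} (hn : s.nreg 0 = n)
    (h1 : s.nreg 1 = 1) (hh : s.rreg 3 = h) (hX : s.rarr 2 = X) (hY : s.rarr 3 = Y) :
    Runs α lineProg s (n * ((n + 1) * 45 + 25) + 6) fun s' =>
      Frame s s' ∧ LineResult α X Y h n s' := by
  refine (Runs.seq (T := 4) (T' := n * ((n + 1) * 45 + 25) + 2) (Runs.block ?_)).mono
    (by omega) fun _ => id
  refine (Runs.forLoop (m := n) (T := (n + 1) * 45 + 23) (fun j s' => Frame s s' ∧ s'.nreg 3 = j ∧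
    LineResult α X Y h j s' ∧ ∀ i < j, s'.rarr 5 i = rowMax (pairs X Y h) i j)
    ?_ ?_ ?_).mono le_rfl ?_
  · rintro j s' ⟨hf, h3, -⟩
    exact ⟨h3, (hf.nreg 0 (by simp)).trans hn⟩
  · refine ⟨⟨fun x hx => ?_, fun x hx => ?_, fun x hx => ?_⟩, ?_, ⟨⟨?_, ?_, ?_, ?_⟩, ?_⟩, ?_⟩
    iterate 3 interval_cases x <;> simp [Instr.run]
    all_goals simp [Instr.run]
  · rintro j s' hj ⟨hf, h3, hr, hrow⟩
    have h1' : s'.nreg 1 = 1 := (hf.nreg 1 (by simp)).trans h1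
    have hh' : s'.rreg 3 = h := (hf.rreg 3 (by simp)).trans hh
    have hX' : s'.rarr 2 = X := (hf.rarr 2 (by simp)).trans hX
    have hY' : s'.rarr 3 = Y := (hf.rarr 3 (by simp)).trans hY
    refine (Runs.seq (T := 16) (T' := (j + 1) * 45 + 7) (Runs.block ?_)).mono (by omega)
      fun _ => id
    refine Runs.seq (T := (j + 1) * 45 + 2) (T' := 5) ?_
    refine (Runs.forLoop (m := j + 1) (T := 43) (fun l s' => Frame s s' ∧
      StartFrame X Y h j l s' ∧ LineResult α X Y h j s' ∧ StartInv α X Y h j l s')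
      ?_ ?_ ?_).mono le_rfl ?_
    · rintro l s' ⟨-, hs, -⟩
      exact ⟨hs.steps, hs.bound⟩
    -- Before any start is inspected, the one-point segment `{j}` serves as the best so far, and
    -- register `8` holds the maximum `0` of the empty segment; minimality is still vacuous.
    · refine ⟨⟨fun x hx => ?_, fun x hx => ?_, fun x hx => ?_⟩,
        ⟨?_, ?_, ?_, ?_, ?_, ?_, ?_, ?_, ?_⟩, ⟨?_, ?_⟩, ⟨?_, fun i hi => ?_, ?_, ?_, ?_, ?_⟩⟩
      iterate 3 interval_cases x <;> simp [Instr.run, hf.nreg, hf.rreg, hf.rarr]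
      case refine_13 => exact hr.opt
      case refine_14 => exact hr.rad
      case refine_16 =>
        rw [if_neg (by omega)]
        rcases hi.eq_or_lt with rfl | hi
        · simp [Instr.run, h3, rowMax_self]
        · simp [Instr.run, h3, hi.ne, hrow i hi]
      case refine_20 => intro i hi hi'; omega
      all_goals simp [Instr.run, h1', hh', hX', hY', h3, segMax_self, segMax_pairs_succ, segCost]
    · rintro l s' hl ⟨hf, hs, hr, hI⟩
      exact runs_startProg hl hf hs hr hI
    · rintro s' ⟨hf, hs, hr, hI⟩
      refine Runs.block ?_
      refine ⟨⟨fun x hx => ?_, fun x hx => ?_, fun x hx => ?_⟩, ?_,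
        ⟨⟨?_, fun k hk => ?_, fun k hk => ?_, fun k hk i hi => ?_⟩, fun k hk => ?_⟩,
        fun i hi => ?_⟩
      iterate 3 interval_cases x <;> simp [Instr.run, hf.nreg, hf.rreg, hf.rarr]
      case refine_4 => simp [Instr.run, hs.last, hs.one]
      case refine_5 => simp [Instr.run, hs.last, hs.one, hr.opt.zero]
      case refine_10 =>
        have := hI.row i (by omega)
        rw [if_pos (by omega)] at this
        simpa [Instr.run] using this
      all_goals rcases Nat.lt_succ_iff_lt_or_eq.1 hk with hk | rfl
      · simp [Instr.run, hs.last, hs.one, hk.ne, hr.opt.start_le k hk]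
      · simp [Instr.run, hs.last, hs.one, hI.start_le]
      -- The new cost goes into cell `j + 1`, beyond every start of an earlier segment, so the
      -- recursion for earlier ends is undisturbed.
      · have := hr.opt.start_le k hk
        simp [Instr.run, hs.last, hs.one, hk.ne, hr.opt.eq k hk]
        rw [Function.update_of_ne (by omega)]
      · have := hI.start_le
        simp [Instr.run, hs.last, hs.one, hI.eq]
        rw [Function.update_of_ne (by omega)]
      · have := hr.opt.le k hk i hi
        simp [Instr.run, hs.last, hs.one, hk.ne]
        rwa [Function.update_of_ne (by omega)]
      · have := hI.le i hi (by omega)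
        simp [Instr.run, hs.last, hs.one]
        rwa [Function.update_of_ne (by omega)]
      · simp [Instr.run, hs.last, hs.one, hk.ne, hr.rad k hk]
      · simp [Instr.run, hs.last, hs.one, hI.rad]
  · rintro s' ⟨hf, -, hr, -⟩
    exact ⟨hf, hr⟩

end RealRAM

namespace RealRAM

open LineCover

/-! ### Writing the cover -/

/-- Raises the register `8` to the least abscissa of a center whose disk, with squared radius in the
register `7`, contains all points from the register `6` to the register `3`. -/
def centerProg : Program :=
  .loop (.nlt 6 3)
    (.seq (block [.rload 9 2 6, .rload 10 3 6, .rsub 10 10 3, .rmul 10 10 10, .rsub 10 7 10,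
        .rsqrt 10 10, .rsub 9 9 10])
      (.seq (rmax 8 9) (block [.nadd 6 6 1])))

/-- Writes the disk for the last segment of an optimal partition of the points before the
register `3`, and replaces that register by the start of this segment. -/
def diskProg : Program :=
  .seq (block [.nsub 7 3 1, .nload 5 0 7, .rload 7 6 7, .rsqrt 8 7, .rload 9 2 5, .rsub 8 9 8,
      .nconst 6 0, .nadd 6 6 5])
    (.seq centerProg
      (block [.rsqrt 7 7, .rstore 0 4 8, .rstore 1 4 7, .nadd 4 4 1, .nconst 3 0, .nadd 3 3 5]))

/-- Writes the cover that belongs to an optimal partition of all points. -/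
def coverProg : Program :=
  .seq (block [.nconst 4 0, .nconst 3 0, .nadd 3 3 0])
    (.seq (.loop (.nle 1 3) diskProg)
      (block [.nconst 0 0, .nadd 0 0 4, .rconst 0 0, .radd 0 0 3]))

/-- What stays constant while the cover is written. -/
structure CoverFrame (X Y : ℕ → ℝ) (h : ℝ) (F R : ℕ → ℝ) (B : ℕ → ℕ) (s : State) : Prop where
  one : s.nreg 1 = 1
  height : s.rreg 3 = h
  x : s.rarr 2 = X
  y : s.rarr 3 = Y
  costs : s.rarr 4 = F
  rads : s.rarr 6 = R
  starts : s.narr 0 = B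

/-- The first `m` output disks contain the points `j, …, n - 1`, and their cost is the difference of
the optimal costs for `n` and for `j` points. -/
structure DiskInv (α : ℝ) (X Y : ℕ → ℝ) (h : ℝ) (F : ℕ → ℝ) (n j m : ℕ) (C R : ℕ → ℝ) : Prop where
  rad_nonneg : ∀ k < m, 0 ≤ R k
  cost : ∑ k ∈ Finset.range m, R k ^ α + F j = F n
  covers : ∀ l, j ≤ l → l < n → ∃ k < m, (X l - C k) ^ 2 + (Y l - h) ^ 2 ≤ R k ^ 2

/-- The cost identity telescopes: the new summand is the drop of `F` from `j` to `b`. -/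
theorem DiskInv.step {α : ℝ} {X Y : ℕ → ℝ} {h : ℝ} {F : ℕ → ℝ} {n j b m : ℕ} {C R : ℕ → ℝ} {c r : ℝ}
    (H : DiskInv α X Y h F n j m C R) (hr : 0 ≤ r) (hF : F j = F b + r ^ α)
    (hc : ∀ l, b ≤ l → l < j → (X l - c) ^ 2 + (Y l - h) ^ 2 ≤ r ^ 2) :
    DiskInv α X Y h F n b (m + 1) (Function.update C m c) (Function.update R m r) where
  rad_nonneg k hk := by
    rcases Nat.lt_succ_iff_lt_or_eq.1 hk with hk | rfl
    · simpa [hk.ne] using H.rad_nonneg k hk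
    · simpa using hr
  cost := by
    rw [Finset.sum_range_succ, ← H.cost, hF, Finset.sum_congr rfl (g := fun k => R k ^ α)]
    · simp; ring
    · intro k hk
      simp [(Finset.mem_range.1 hk).ne]
  covers l hl hln := by
    rcases lt_or_ge l j with hlj | hlj
    · exact ⟨m, by omega, by simpa using hc l hl hlj⟩
    · obtain ⟨k, hk, e⟩ := H.covers l hlj hln
      exact ⟨k, by omega, by simpa [hk.ne] using e⟩

/-- Helly's theorem made effective: the largest left endpoint of the intervals of admissible centers
lies in all of them, since no left endpoint exceeds a right endpoint. -/
theorem runs_centerProg {α : ℝ} {s : State} {X Y : ℕ → ℝ} {h : ℝ} {F R : ℕ → ℝ} {B : ℕ → ℕ}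
    {b j m : ℕ} (hs : CoverFrame X Y h F R B s) (hj : s.nreg 3 = j) (hm : s.nreg 4 = m)
    (hb : s.nreg 5 = b) (hb' : s.nreg 6 = b) (hbj : b < j)
    (hR : s.rreg 7 = segMax (pairs X Y h) b j) (h8 : s.rreg 8 = X b - √(s.rreg 7)) :
    Runs α centerProg s (j * 15 + 1) fun s' =>
      CoverFrame X Y h F R B s' ∧ s'.rarr = s.rarr ∧ s'.nreg 3 = j ∧ s'.nreg 4 = m ∧ s'.nreg 5 = b ∧
      s'.nreg 0 = s.nreg 0 ∧
      s'.rreg 7 = segMax (pairs X Y h) b j ∧ ∀ l, b ≤ l → l < j →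
        (X l - s'.rreg 8) ^ 2 + (Y l - h) ^ 2 ≤ segMax (pairs X Y h) b j := by
  set ρ := segMax (pairs X Y h) b j
  refine (Runs.countLoop (m := j) (T := 14) (fun k s' => (CoverFrame X Y h F R B s' ∧
    s'.rarr = s.rarr ∧ s'.nreg 3 = j ∧ s'.nreg 4 = m ∧ s'.nreg 5 = b ∧ s'.nreg 0 = s.nreg 0 ∧
    s'.rreg 7 = ρ) ∧ b ≤ k ∧ s'.nreg 6 = k ∧
    (∀ l, b ≤ l → l < k → X l - √(ρ - (Y l - h) * (Y l - h)) ≤ s'.rreg 8) ∧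
    ∀ l, b ≤ l → l < j → s'.rreg 8 ≤ X l + √(ρ - (Y l - h) * (Y l - h)))
    ?_ ?_ (k := b) hbj.le ?_).mono (by gcongr; omega) ?_
  · rintro k s' - ⟨⟨-, -, h3, -⟩, -, h6, -⟩
    simp [Test.Holds, h3, h6]
  · rintro k s' hk ⟨⟨hs, ha, h3, h4, h5, h0, h7⟩, hbk, h6, hlow, hup⟩
    refine (Runs.seq (T := 8) (T' := 6) (Runs.block ?_)).mono (by omega) fun _ => id
    refine Runs.seq (T := 4) (T' := 2) (Runs.rmax (by simp) (Runs.block ?_))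
    refine ⟨⟨⟨?_, ?_, ?_, ?_, ?_, ?_, ?_⟩, ?_, ?_, ?_, ?_, ?_, ?_⟩, ?_, ?_, fun l hl hlk => ?_,
      fun l hl hlj => ?_⟩
    case refine_14 => omega
    case refine_16 =>
      rcases Nat.lt_succ_iff_lt_or_eq.1 hlk with hlk | rfl
      · simp [Instr.run, hs.x, hs.y, hs.height, h6, h7, hlow l hl hlk]
      · simp [Instr.run, hs.x, hs.y, hs.height, h6, h7]
    case refine_17 =>
      have := max_le (hup l hl hlj) (sub_sqrt_le_add_sqrt X Y h hl hlj hbk hk)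
      simpa [Instr.run, hs.x, hs.y, hs.height, h6, h7] using this
    case refine_8 => simpa [Instr.run] using ha
    all_goals simp [Instr.run, hs.one, hs.height, hs.x, hs.y, hs.costs, hs.rads, hs.starts, h3,
      h4, h5, h6, h7, h0]
  · refine ⟨⟨hs, rfl, hj, hm, hb, rfl, hR⟩, le_rfl, hb', fun l hl hl' => by omega,
      fun l hl hlj => ?_⟩
    -- The initial value `X b - √ρ` is at most the left endpoint that belongs to `b`, so it is at
    -- most every right endpoint.
    refine le_trans ?_ (sub_sqrt_le_add_sqrt X Y h hl hlj le_rfl hbj)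
    rw [h8, hR]
    gcongr
    linarith [mul_self_nonneg (Y b - h)]
  · rintro s' ⟨⟨hs, ha, h3, h4, h5, h0, h7⟩, -, -, hlow, hup⟩
    refine ⟨hs, ha, h3, h4, h5, h0, h7, fun l hl hlj => ?_⟩
    have h1 := hlow l hl hlj
    have h2 := hup l hl hlj
    have h3 : |X l - s'.rreg 8| ≤ √(ρ - (Y l - h) * (Y l - h)) :=
      abs_le.2 ⟨by linarith, by linarith⟩
    have h4 := mul_self_le_mul_self (abs_nonneg _) h3
    rw [abs_mul_abs_self, Real.mul_self_sqrt (sub_nonneg.2 (sq_le_segMax X Y h hl hlj))] at h4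
    linarith

theorem runs_coverProg {α : ℝ} {s : State} {n : ℕ} {X Y : ℕ → ℝ} {h : ℝ} (hn : s.nreg 0 = n)
    (h1 : s.nreg 1 = 1) (hh : s.rreg 3 = h) (hX : s.rarr 2 = X) (hY : s.rarr 3 = Y)
    (hr : LineResult α X Y h n s) :
    Runs α coverProg s (n * (n * 15 + 18) + 10) fun s' =>
      s'.rreg 0 = h ∧
      DiskInv α X Y h (s.rarr 4) n 0 (s'.nreg 0) (s'.rarr 0) (s'.rarr 1) := by
  have hs : CoverFrame X Y h (s.rarr 4) (s.rarr 6) (s.narr 0) s := ⟨h1, hh, hX, hY, rfl, rfl, rfl⟩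
  set F := s.rarr 4
  set R := s.rarr 6
  set B := s.narr 0
  refine (Runs.seq (T := 4) (T' := n * (n * 15 + 18) + 6) (Runs.block ?_)).mono (by omega)
    fun _ => id
  refine Runs.seq (T := n * (n * 15 + 18) + 1) (T' := 5) ?_
  -- The loop index is the number of points not yet covered; a round moves it from `j + 1` to `B j ≤
  -- j`. Arrays `0` and `1` may be overwritten, as the sorted clients are in `2` and `3`.
  refine (Runs.loop (T := n * 15 + 17) (fun j s' => CoverFrame X Y h F R B s' ∧ s'.nreg 3 = j ∧
    j ≤ n ∧ DiskInv α X Y h F n j (s'.nreg 4) (s'.rarr 0) (s'.rarr 1)) ?_ ?_ (v := n) ?_).mono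
    le_rfl ?_
  · rintro j s' ⟨hs, h3, -⟩
    simp [Test.Holds, hs.one, h3, Nat.one_le_iff_ne_zero, Nat.pos_iff_ne_zero]
  · rintro j s' hj ⟨hs, h3, hjn, hD⟩
    obtain ⟨j, rfl⟩ : ∃ k, j = k + 1 := ⟨j - 1, by omega⟩
    have hB : B j ≤ j := hr.opt.start_le j hjn
    refine (Runs.seq (T := 9) (T' := n * 15 + 8) (Runs.block ?_)).mono (by omega) fun _ => id
    refine (Runs.seq (T := (j + 1) * 15 + 1) (T' := 7) ((runs_centerProg (X := X) (Y := Y) (h := h)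
      (F := F) (R := R) (B := B) (b := B j) (j := j + 1) (m := s'.nreg 4) ⟨?_, ?_, ?_, ?_, ?_, ?_, ?_⟩
      ?_ ?_ ?_ ?_ (by omega) ?_ ?_).mono le_rfl ?_)).mono (by nlinarith) fun _ => id
    case refine_14 =>
      rintro s'' ⟨hs'', ha, h3', h4', h5', -, h7, hc⟩
      refine Runs.block ⟨B j, by omega, ⟨?_, ?_, ?_, ?_, ?_, ?_, ?_⟩, ?_, by omega, ?_⟩
      case refine_9 =>
        have := hD.step (b := B j) (r := √(segMax (pairs X Y h) (B j) (j + 1))) (Real.sqrt_nonneg _)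
          (hr.opt.eq j hjn) (c := s''.rreg 8) fun l hl hlj => by
            rw [Real.sq_sqrt (segMax_nonneg _ _ _)]
            exact hc l hl hlj
        simpa [Instr.run, ha, h4', h5', h7, hs''.one] using this
      all_goals simp [Instr.run, hs''.one, hs''.height, hs''.x, hs''.y, hs''.costs, hs''.rads,
        hs''.starts, h5']
    all_goals simp [Instr.run, hs.one, hs.height, hs.x, hs.y, hs.costs, hs.rads, hs.starts, h3]
    exact hr.rad j hjn
  · refine ⟨⟨?_, ?_, ?_, ?_, ?_, ?_, ?_⟩, ?_, le_rfl, ⟨?_, ?_, ?_⟩⟩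
    case refine_11 => intro l hl hl'; omega
    all_goals simp [Instr.run, hn, hs.one, hs.height, hs.x, hs.y, F, R, B]
  · rintro s' ⟨hs, h3, -, hD⟩
    exact Runs.block ⟨by simp [Instr.run, hs.height], by simpa [Instr.run] using hD⟩

end RealRAM

namespace RealRAM

open LineCover

/-! ### The search for a height -/

/-- Computes the cost for the height with the number in the integer register `2`, and keeps the best
height so far and its cost in the registers `4` and `5`. -/
def candidateProg : Program :=
  .seq (block [.rdiv 7 7 6, .rsub 8 2 1, .rmul 7 7 8, .radd 3 1 7])
    (.seq lineProg
      (.seq (block [.rload 7 4 0])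
        (.seq (.cond (.rlt 7 5) (block [.rconst 5 0, .radd 5 5 7, .rconst 4 0, .radd 4 4 3]) .skip)
          (block [.nadd 2 2 1, .rcast 7 2, .rmul 7 7 0]))))

/-- The approximation scheme, with about `K * n / ε` candidates for the height of the line. -/
def mainProg (K : ℕ) : Program :=
  .seq (block [.nconst 1 1]) (.seq sortProg (.seq rangeProg
    (.seq (block [.rconst 7 K, .rcast 8 0, .rmul 6 7 8, .rconst 3 0, .radd 3 3 1])
      (.seq lineProg
        (.seq (block [.rload 5 4 0, .rconst 4 0, .radd 4 4 3, .nconst 2 0, .rconst 7 0])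
          (.seq (.loop (.rle 7 6) candidateProg)
            (.seq (block [.rconst 3 0, .radd 3 3 4])
              (.seq lineProg coverProg))))))))

/-- The height with number `k`. -/
noncomputable def candidate (ε L lo hi : ℝ) (k : ℕ) : ℝ := lo + k * ε / L * (hi - lo)

/-- What stays constant during the search. -/
structure SearchFrame (n : ℕ) (ε L lo hi : ℝ) (X Y : ℕ → ℝ) (s : State) : Prop where
  n : s.nreg 0 = n
  one : s.nreg 1 = 1
  eps : s.rreg 0 = ε
  lo : s.rreg 1 = lo
  hi : s.rreg 2 = hi
  size : s.rreg 6 = L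
  x : s.rarr 2 = X
  y : s.rarr 3 = Y

/-- The registers `4` and `5` hold the best height among the first `k` candidates and its cost. -/
structure SearchInv (α : ℝ) (n : ℕ) (ε L lo hi : ℝ) (X Y : ℕ → ℝ) (k : ℕ) (s : State) : Prop where
  count : s.nreg 2 = k
  test : s.rreg 7 = k * ε
  eq : ∃ F B, IsOptPartition (segCost α X Y (s.rreg 4)) n F B ∧ F n = s.rreg 5
  le : ∀ k' < k, ∃ F B, IsOptPartition (segCost α X Y (candidate ε L lo hi k')) n F B ∧
    s.rreg 5 ≤ F n

/-- A bound for the running time of `lineProg`. -/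
def lineTime (n : ℕ) : ℕ := n * ((n + 1) * 45 + 25) + 6

theorem runs_candidateProg {α : ℝ} {s : State} {n k : ℕ} {ε L lo hi : ℝ} {X Y : ℕ → ℝ}
    (hs : SearchFrame n ε L lo hi X Y s) (hI : SearchInv α n ε L lo hi X Y k s) :
    Runs α candidateProg s (lineTime n + 17) fun s' => SearchFrame n ε L lo hi X Y s' ∧
      SearchInv α n ε L lo hi X Y (k + 1) s' := by
  refine (Runs.seq (T := 5) (T' := lineTime n + 12) (Runs.block ?_)).mono (by omega) fun _ => id
  refine (Runs.seq (T := lineTime n) (T' := 12) ((runs_lineProg (n := n) (X := X) (Y := Y)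
    (h := candidate ε L lo hi k) ?_ ?_ ?_ ?_ ?_).mono le_rfl ?_)).mono (by omega) fun _ => id
  iterate 5 simp [Instr.run, hs.n, hs.one, hs.x, hs.y, hs.lo, hs.hi, hs.size, hI.test, candidate]
  rintro s' ⟨hf, hr⟩
  have f0 : s'.nreg 0 = n := by simpa [Instr.run, hs.n] using hf.nreg 0 (by simp)
  have f1 : s'.nreg 1 = 1 := by simpa [Instr.run, hs.one] using hf.nreg 1 (by simp)
  have f2 : s'.nreg 2 = k := by simpa [Instr.run, hI.count] using hf.nreg 2 (by simp)
  have r0 : s'.rreg 0 = ε := by simpa [Instr.run, hs.eps] using hf.rreg 0 (by simp)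
  have r1 : s'.rreg 1 = lo := by simpa [Instr.run, hs.lo] using hf.rreg 1 (by simp)
  have r2 : s'.rreg 2 = hi := by simpa [Instr.run, hs.hi] using hf.rreg 2 (by simp)
  have r3 : s'.rreg 3 = candidate ε L lo hi k := by
    simpa [Instr.run, hs.lo, hs.hi, hs.size, hI.test, candidate] using hf.rreg 3 (by simp)
  have r4 : s'.rreg 4 = s.rreg 4 := by simpa [Instr.run] using hf.rreg 4 (by simp)
  have r5 : s'.rreg 5 = s.rreg 5 := by simpa [Instr.run] using hf.rreg 5 (by simp)
  have r6 : s'.rreg 6 = L := by simpa [Instr.run, hs.size] using hf.rreg 6 (by simp)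
  have ax : s'.rarr 2 = X := by simpa [Instr.run, hs.x] using hf.rarr 2 (by simp)
  have ay : s'.rarr 3 = Y := by simpa [Instr.run, hs.y] using hf.rarr 3 (by simp)
  refine Runs.seq (T := 2) (T' := 10) (Runs.block ?_)
  refine Runs.seq (T := 6) (T' := 4) (Runs.cond (T := 5)
    (fun hb => (Runs.block (Runs.block ?_)).mono (by simp) fun _ => id)
    fun hb => (Runs.skip (Runs.block ?_)).mono (by omega) fun _ => id)
  · have hlt : s'.rarr 4 n < s.rreg 5 := by simpa [Test.Holds, Instr.run, f0, r5] using hb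
    refine ⟨⟨?_, ?_, ?_, ?_, ?_, ?_, ?_, ?_⟩, ?_, ?_, ?_, ?_⟩
    case refine_11 =>
      refine ⟨s'.rarr 4, s'.narr 0, ?_, ?_⟩
      · simpa [Instr.run, r3] using hr.opt
      · simp [Instr.run, f0]
    case refine_12 =>
      intro k' hk'
      rcases Nat.lt_succ_iff_lt_or_eq.1 hk' with hk' | rfl
      · obtain ⟨F, B, h1, h2⟩ := hI.le k' hk'
        exact ⟨F, B, h1, by simpa [Instr.run, f0] using hlt.le.trans h2⟩
      · exact ⟨_, _, hr.opt, by simp [Instr.run, f0]⟩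
    all_goals simp [Instr.run, f0, f1, f2, r0, r1, r2, r6, ax, ay]
  · have hle : s.rreg 5 ≤ s'.rarr 4 n := by simpa [Test.Holds, Instr.run, f0, r5] using hb
    refine ⟨⟨?_, ?_, ?_, ?_, ?_, ?_, ?_, ?_⟩, ?_, ?_, ?_, ?_⟩
    case refine_11 => simpa [Instr.run, r4, r5] using hI.eq
    case refine_12 =>
      intro k' hk'
      rcases Nat.lt_succ_iff_lt_or_eq.1 hk' with hk' | rfl
      · simpa [Instr.run, r5] using hI.le k' hk'
      · exact ⟨_, _, hr.opt, by simpa [Instr.run, r5] using hle⟩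
    all_goals simp [Instr.run, f0, f1, f2, r0, r1, r2, r6, ax, ay]

/-- A bound for the running time of `mainProg` if there are `m` candidates. -/
def mainTime (n m : ℕ) : ℕ :=
  n * (n * 14 + 11) + n * 12 + (m * (lineTime n + 18) + 2 * lineTime n) +
    n * (n * 15 + 18) + 40

/-- Each run of `lineProg` overwrites the last partition, so the search keeps only the best height
and its cost, and the partition for that height is recomputed at the end. A preliminary run at `lo`
initializes the search. -/
theorem runs_mainProg {α : ℝ} {s : State} {n K : ℕ} {ε : ℝ} {X₀ Y₀ : ℕ → ℝ} (hε : 0 < ε)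
    (hn : s.nreg 0 = n) (heps : s.rreg 0 = ε) (hX₀ : s.rarr 0 = X₀) (hY₀ : s.rarr 1 = Y₀) :
    Runs α (mainProg K) s (mainTime n (⌊(K * n : ℝ) / ε⌋₊ + 1)) fun s' =>
      ∃ X Y lo hi F, IsSorting X₀ Y₀ n X Y ∧ IsRange Y n lo hi ∧ F 0 = 0 ∧
        DiskInv α X Y (s'.rreg 0) F n 0 (s'.nreg 0) (s'.rarr 0) (s'.rarr 1) ∧
        ∀ k : ℕ, k * ε ≤ K * n → ∃ F' B',
          IsOptPartition (segCost α X Y (candidate ε (K * n) lo hi k)) n F' B' ∧ F n ≤ F' n := by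
  set m := ⌊(K * n : ℝ) / ε⌋₊ + 1 with hm
  -- The program rounds nothing: it compares `k * ε` with `K * n`. The floor appears only in the
  -- count of the rounds.
  have hkm : ∀ k : ℕ, (k : ℝ) * ε ≤ K * n ↔ k < m := by
    intro k
    rw [hm, Nat.lt_succ_iff, Nat.le_floor_iff (by positivity), le_div_iff₀ hε]
  refine Runs.mono (T := 2 + (n * (n * 14 + 11) + 2 + (n * 12 + 6 + (6 + (lineTime n + (6 +
    (m * (lineTime n + 18) + 1 + (3 + (lineTime n + (n * (n * 15 + 18) + 10))))))))))
    ?_ (by simp only [mainTime]; omega) fun _ => id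
  refine Runs.seq (Runs.block ?_)
  refine Runs.seq ((runs_sortProg (n := n) (ε := ε) (X₀ := X₀) (Y₀ := Y₀) ?_).mono le_rfl ?_)
  · constructor <;> simp [Instr.run, hn, heps, hX₀, hY₀]
  rintro s₁ ⟨hs₁, hsort⟩
  set X := s₁.rarr 2
  set Y := s₁.rarr 3
  refine Runs.seq ((runs_rangeProg hs₁ rfl rfl).mono le_rfl ?_)
  rintro s₂ ⟨hs₂, hX₂, hY₂, hrange⟩
  set lo := s₂.rreg 1 with hlo
  set hi := s₂.rreg 2 with hhi
  refine Runs.seq (Runs.block ?_)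
  refine Runs.seq ((runs_lineProg (n := n) (X := X) (Y := Y) (h := lo) ?_ ?_ ?_ ?_ ?_).mono le_rfl ?_)
  iterate 5 simp [Instr.run, hs₂.n, hs₂.one, hX₂, hY₂, ← hlo, X, Y]
  rintro s₃ ⟨hf, hr⟩
  have f0 : s₃.nreg 0 = n := by simpa [Instr.run, hs₂.n] using hf.nreg 0 (by simp)
  have f1 : s₃.nreg 1 = 1 := by simpa [Instr.run, hs₂.one] using hf.nreg 1 (by simp)
  have r0 : s₃.rreg 0 = ε := by simpa [Instr.run, hs₂.eps] using hf.rreg 0 (by simp)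
  have r1 : s₃.rreg 1 = lo := by simpa [Instr.run] using hf.rreg 1 (by simp)
  have r2 : s₃.rreg 2 = hi := by simpa [Instr.run] using hf.rreg 2 (by simp)
  have r3 : s₃.rreg 3 = lo := by simpa [Instr.run] using hf.rreg 3 (by simp)
  have r6 : s₃.rreg 6 = K * n := by simpa [Instr.run, hs₂.n] using hf.rreg 6 (by simp)
  have ax : s₃.rarr 2 = X := by simpa [Instr.run, hX₂] using hf.rarr 2 (by simp)
  have ay : s₃.rarr 3 = Y := by simpa [Instr.run, hY₂] using hf.rarr 3 (by simp)
  refine Runs.seq (Runs.block ?_)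
  refine Runs.seq ((Runs.countLoop (k := 0) (m := m) (T := lineTime n + 17)
    (fun k s => SearchFrame n ε (K * n) lo hi X Y s ∧ SearchInv α n ε (K * n) lo hi X Y k s)
    ?_ ?_ (Nat.zero_le _) ?_).mono (by simp) ?_)
  · rintro k s - ⟨hs, hI⟩
    simp only [Test.Holds, hs.size, hI.test, hkm]
  · rintro k s - ⟨hs, hI⟩
    exact runs_candidateProg hs hI
  · refine ⟨⟨?_, ?_, ?_, ?_, ?_, ?_, ?_, ?_⟩, ?_, ?_, ⟨s₃.rarr 4, s₃.narr 0, ?_, ?_⟩, ?_⟩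
    case refine_11 => simpa [Instr.run, r3] using hr.opt
    all_goals simp [Instr.run, f0, f1, r0, r1, r2, r6, ax, ay]
  rintro s₄ ⟨hs₄, hI⟩
  refine Runs.seq (Runs.block ?_)
  refine Runs.seq ((runs_lineProg (n := n) (X := X) (Y := Y) (h := s₄.rreg 4)
    ?_ ?_ ?_ ?_ ?_).mono le_rfl ?_)
  iterate 5 simp [Instr.run, hs₄.n, hs₄.one, hs₄.x, hs₄.y]
  rintro s₅ ⟨hf, hr⟩
  have f0 : s₅.nreg 0 = n := by simpa [Instr.run, hs₄.n] using hf.nreg 0 (by simp)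
  have f1 : s₅.nreg 1 = 1 := by simpa [Instr.run, hs₄.one] using hf.nreg 1 (by simp)
  have r3 : s₅.rreg 3 = s₄.rreg 4 := by simpa [Instr.run] using hf.rreg 3 (by simp)
  have ax : s₅.rarr 2 = X := by simpa [Instr.run, hs₄.x] using hf.rarr 2 (by simp)
  have ay : s₅.rarr 3 = Y := by simpa [Instr.run, hs₄.y] using hf.rarr 3 (by simp)
  refine (runs_coverProg f0 f1 r3 ax ay hr).mono le_rfl ?_
  rintro s₆ ⟨h0, hD⟩
  refine ⟨X, Y, lo, hi, s₅.rarr 4, hsort, hrange, hr.opt.zero, h0 ▸ hD, fun k hk => ?_⟩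
  obtain ⟨F, B, hF, hFn⟩ := hI.eq
  obtain ⟨F', B', hF', hle⟩ := hI.le k ((hkm k).1 hk)
  exact ⟨F', B', hF', ((hr.opt.unique hF le_rfl).trans_eq hFn).trans hle⟩

end RealRAM

/-! ### Running time and approximation ratio -/

theorem LineCover.mem_closedBall_iff {q : EuclideanSpace ℝ (Fin 2)} {c h r : ℝ} (hr : 0 ≤ r) :
    q ∈ Metric.closedBall !₂[c, h] r ↔ (q 0 - c) ^ 2 + (q 1 - h) ^ 2 ≤ r ^ 2 := by
  rw [Metric.mem_closedBall, EuclideanSpace.dist_eq, Real.sqrt_le_left hr]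
  simp [Fin.sum_univ_two, Real.dist_eq, sq_abs]

namespace RealRAM

open LineCover

/-- The search dominates: at most `(K + 1) * N / ε` rounds of at most `90 * N ^ 2` steps each. -/
theorem mainTime_le {n K : ℕ} {ε : ℝ} (hε : 0 < ε) (hε1 : ε ≤ 1) :
    (mainTime n (⌊(K * n : ℝ) / ε⌋₊ + 1) : ℝ) ≤
      (2000 * (K + 1)) * (((max n 2 : ℕ) : ℝ) ^ 3 / ε * Real.log ((max n 2 : ℕ) : ℝ)) := by
  set N : ℝ := ((max n 2 : ℕ) : ℝ) with hN
  have hnN : (n : ℝ) ≤ N := by rw [hN]; exact_mod_cast le_max_left n 2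
  have hN2 : 2 ≤ N := by rw [hN]; exact_mod_cast le_max_right n 2
  have hfl : (⌊(K * n : ℝ) / ε⌋₊ : ℝ) ≤ K * (N / ε) := by
    rw [← mul_div_assoc]
    exact (Nat.floor_le (by positivity)).trans (by gcongr)
  set u : ℝ := N / ε with hu
  have hu2 : 2 ≤ u := by
    rw [hu, le_div_iff₀ hε]
    nlinarith
  set m : ℝ := (⌊(K * n : ℝ) / ε⌋₊ : ℝ)
  have hm0 : 0 ≤ m := Nat.cast_nonneg _
  have hn0 : (0 : ℝ) ≤ n := Nat.cast_nonneg n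
  have hn2 : (n : ℝ) * n ≤ N * N := mul_self_le_mul_self hn0 hnN
  have hNN : 2 * N ≤ N * N := by nlinarith
  have hline : (lineTime n : ℝ) + 18 ≤ 90 * (N * N) := by
    simp only [lineTime]
    push_cast
    nlinarith
  have hm : (m + 1) * ((lineTime n : ℝ) + 18) ≤ ((K + 1) * u) * (90 * (N * N)) := by
    refine mul_le_mul (by linarith) hline (by positivity) (by positivity)
  -- The logarithm is not needed by the algorithm; being at least `1 / 2`, it costs only a doubling
  -- of the constant `1000`.
  have hlog : 1 / 2 ≤ Real.log N := by
    have h1 := Real.log_le_log (by norm_num) hN2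
    linarith [Real.log_two_gt_d9]
  have hP : N * N ≤ (K + 1) * u * (N * N) := by
    refine le_mul_of_one_le_left (by positivity) ?_
    nlinarith [(Nat.cast_nonneg K : (0 : ℝ) ≤ K)]
  calc (mainTime n (⌊(K * n : ℝ) / ε⌋₊ + 1) : ℝ)
      = n * (n * 14 + 11) + n * 12 + ((m + 1) * (lineTime n + 18) + 2 * lineTime n) +
        n * (n * 15 + 18) + 40 := by
        simp only [mainTime, m]
        push_cast
        ring
    _ ≤ 1000 * ((K + 1) * u * (N * N)) := by nlinarith
    _ ≤ (2000 * (K + 1) * (u * (N * N))) * Real.log N := by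
        have : 0 ≤ (K + 1) * u * (N * N) := by positivity
        nlinarith
    _ = _ := by rw [hu]; ring

/-- What the output of the program is worth, when the clients are sorted. -/
theorem output_cost_le {α ε : ℝ} (hα : 1 ≤ α) (hε : 0 < ε) (hε1 : ε ≤ 1) {n K : ℕ}
    (hK : 4 * α ≤ K) {p : Fin n → EuclideanSpace ℝ (Fin 2)} {X Y F : ℕ → ℝ} {lo hi : ℝ}
    (hsort : IsSorting ((input p ε).rarr 0) ((input p ε).rarr 1) n X Y) (hrange : IsRange Y n lo hi)
    (hF : F 0 = 0)
    (hle : ∀ k : ℕ, k * ε ≤ K * n → ∃ F' B',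
      IsOptPartition (segCost α X Y (candidate ε (K * n) lo hi k)) n F' B' ∧ F n ≤ F' n)
    {D : LineCover} (hD : D.Covers p) : F n ≤ (1 + ε) * D.cost α := by
  have hα0 : 0 ≤ α := by linarith
  have hD0 : ∀ j, 0 ≤ D.radius j ^ α := fun j => Real.rpow_nonneg (hD.1 j) α
  rcases Nat.eq_zero_or_pos n with rfl | hn
  · rw [hF]
    exact mul_nonneg (by linarith) (Finset.sum_nonneg fun j _ => hD0 j)
  have H : ∀ a : Fin n, ∃ j, (X a - D.center j) ^ 2 + (Y a - D.height) ^ 2 ≤ D.radius j ^ 2 := by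
    intro a
    obtain ⟨l, hl, e1, e2⟩ := hsort.exists_eq' a a.2
    obtain ⟨j, hj⟩ := hD.2 ⟨l, hl⟩
    rw [mem_closedBall_iff (hD.1 j)] at hj
    refine ⟨j, ?_⟩
    simpa [e1, e2, input, hl] using hj
  choose f hf using H
  classical
  -- The given cover may have arbitrarily many disks; one chosen disk per client leaves at most `n`,
  -- as the bound on the growth of the radii requires.
  obtain ⟨k, r, hk, hr, hcov, hsum⟩ := exists_candidate_sum_le (X := X) (c := D.center)
    (r := D.radius) (h := D.height) (J := Finset.univ.image f) hα hε hε1 hn hK hrange.lo_le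
    hrange.le_hi (hrange.exists_lo hn) (hrange.exists_hi hn)
    (Finset.card_image_le.trans (by simp)) (fun j _ => hD.1 j)
    fun a ha => ⟨f ⟨a, ha⟩, by simp, hf ⟨a, ha⟩⟩
  obtain ⟨F', B', hF', hFn⟩ := hle k hk
  calc F n ≤ F' n := hFn
    _ ≤ ∑ j ∈ Finset.univ.image f, r j ^ α := hF'.le_sum hα0 hsort.mono le_rfl hr hcov
    _ ≤ (1 + ε) * ∑ j ∈ Finset.univ.image f, D.radius j ^ α := hsum
    _ ≤ (1 + ε) * D.cost α := by
        gcongr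
        exact Finset.sum_le_sum_of_subset_of_nonneg (Finset.subset_univ _) fun j _ _ => hD0 j

end RealRAM

/-- For each fixed `α ≥ 1` one real-RAM program, with input `n` clients and `ε ∈ (0, 1]`, outputs a
horizontal line and a cover by disks centered on it of cost at most `1 + ε` times the cost of any
cover by disks centered on any one horizontal line, within the stated time (where `n` is read as
`max n 2`, so that `log n` does not vanish). -/
theorem mainTheorem6 (α : ℝ) (hα : 1 ≤ α) :
    ∃ (P : RealRAM.Program) (C : ℝ),
      ∀ (n : ℕ) (p : Fin n → EuclideanSpace ℝ (Fin 2)) (ε : ℝ), 0 < ε → ε ≤ 1 →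
        ∃ (t : ℕ) (s : RealRAM.State),
          RealRAM.Exec α P (RealRAM.input p ε) t s ∧
          (RealRAM.output s).Covers p ∧
          (∀ D : LineCover, D.Covers p →
            (RealRAM.output s).cost α ≤ (1 + ε) * D.cost α) ∧
          (α = 1 →
            (t : ℝ) ≤ C * (((max n 2 : ℕ) : ℝ) ^ 3 / ε * Real.log ((max n 2 : ℕ) : ℝ))) ∧
          (1 < α →
            (t : ℝ) ≤ C * (((max n 2 : ℕ) : ℝ) ^ 5 / ε * Real.log ((max n 2 : ℕ) : ℝ))) := by
  refine ⟨RealRAM.mainProg ⌈4 * α⌉₊, 2000 * ((⌈4 * α⌉₊ : ℕ) + 1), fun n p ε hε hε1 => ?_⟩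
  obtain ⟨t, s, hexec, ht, X, Y, lo, hi, F, hsort, hrange, hF, hD, hle⟩ :=
    RealRAM.runs_mainProg (α := α) (s := RealRAM.input p ε) (K := ⌈4 * α⌉₊) (n := n) hε
      (by simp [RealRAM.input]) (by simp [RealRAM.input]) rfl rfl
  have ht' : (t : ℝ) ≤ _ := (Nat.cast_le.2 ht).trans (RealRAM.mainTime_le hε hε1)
  have hcost : (RealRAM.output s).cost α = F n := by
    rw [← hD.cost, hF, add_zero, Finset.sum_range]
    rfl
  refine ⟨t, s, hexec, ⟨fun j => hD.rad_nonneg j j.2, fun i => ?_⟩, fun D hDp => ?_, fun _ => ht',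
    fun _ => ht'.trans ?_⟩
  · obtain ⟨a, ha, e1, e2⟩ := hsort.exists_eq i i.2
    obtain ⟨k, hk, h⟩ := hD.covers a (Nat.zero_le a) ha
    refine ⟨⟨k, hk⟩, (LineCover.mem_closedBall_iff (hD.rad_nonneg k hk)).2 ?_⟩
    simpa [e1, e2, RealRAM.input, RealRAM.output] using h
  · rw [hcost]
    exact RealRAM.output_cost_le hα hε hε1 (Nat.le_ceil _) hsort hrange hF hle hDp
  -- For `α > 1` the cubic bound is weakened to the fifth power, as `N ≥ 1`.
  · have hN : (1 : ℝ) ≤ ((max n 2 : ℕ) : ℝ) := by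
      exact_mod_cast le_trans (by norm_num) (le_max_right n 2)
    have hlog := Real.log_nonneg hN
    gcongr
    norm_num
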